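/- Let $n\ge 2$ and $m\ge 2$ be integers, and let all functions be real-valued, or all be complex-valued. For $0<p<\infty$ and $0<\kappa<1$ the Morrey space $L^{p,\kappa}(\mathbb R^n)$ and the weak Morrey space $WL^{p,\kappa}(\mathbb R^n)$ consist of the measurable functions $f$ on $\mathbb R^n$ for which, respectively, $$\|f\|_{L^{p,\kappa}}:=\sup_{B}\Big(\frac{1}{m(B)^{\kappa}}\int_B|f(x)|^p\,dx\Big)^{1/p}<\infty,\qquad \|f\|_{WL^{p,\kappa}}:=\sup_{B}\sup_{\lambda>0}\frac{\lambda}{m(B)^{\kappa/p}}\,m\big(\{x\in B:|f(x)|>\lambda\}\big)^{1/p}<\infty,$$ where $B$ runs over all open balls of $\mathbb R^n$ and $m(\cdot)$ is Lebesgue measure. Let $1<s\le\infty$, and let $s'=s/(s-1)$ if $s<\infty$, $s'=1$ if $s=\infty$. Let $\Omega_1,\dots,\Omega_m$ be functions on $\mathbb R^n$ that are homogeneous of degree zero, that is, $\Omega_i(\lambda x)=\Omega_i(x)$ for all $\lambda>0$ and $x\in\mathbb R^n$, and whose restrictions to the unit sphere belong to $L^s(\mathbf S^{n-1})$ for the normalized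 surface measure. For $0<\alpha<mn$ put $$\mathcal T_{\Omega,\alpha;m}(\vec g)(x):=\int_{(\mathbb R^n)^m}\frac{\Omega_1(x-y_1)\cdots\Omega_m(x-y_m)}{\big(\sum_{j=1}^m|x-y_j|^2\big)^{(mn-\alpha)/2}}\;g_1(y_1)\cdots g_m(y_m)\,dy_1\cdots dy_m .$$ **Theorem.** Let $0<\alpha<mn$, $1\le p<\infty$, $s'\le p_1,\dots,p_m<\infty$, $0<\kappa<1$, and $$\frac1p+\sum_{i=1}^m\frac1{p_i}=\frac1r+\frac{\alpha}{n(1-\kappa)},\qquad \frac1q=\sum_{i=1}^m\frac1{p_i}-\frac{\alpha}{n(1-\kappa)},\qquad 0<r<\min\{p,q\}.$$ (i) If $p_i>s'$ for every $i$, then there is a constant $C>0$ such that for all $f\in L^{p,\kappa}(\mathbb R^n)$ and all $\vec g=(g_1,\dots,g_m)\in L^{p_1,\kappa}(\mathbb R^n)\times\cdots\times L^{p_m,\kappa}(\mathbb R^n)$ the integral defining $\mathcal T_{\Omega,\alpha;m}(\vec g)(x)$ converges absolutely for almost every $x$, the function $f\cdot\mathcal T_{\Omega,\alpha;m}(\vec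 g)$ belongs to $L^{r,\kappa}(\mathbb R^n)$, and $$\big\|f\cdot\mathcal T_{\Omega,\alpha;m}(\vec g)\big\|_{L^{r,\kappa}}\le C\,\|f\|_{L^{p,\kappa}}\prod_{i=1}^m\|g_i\|_{L^{p_i,\kappa}} .$$ (ii) If $\min\{p_1,\dots,p_m\}=s'$, then there is a constant $C>0$ such that for all such $f$ and $\vec g$ the integral defining $\mathcal T_{\Omega,\alpha;m}(\vec g)(x)$ converges absolutely for almost every $x$, the function $f\cdot\mathcal T_{\Omega,\alpha;m}(\vec g)$ belongs to $WL^{r,\kappa}(\mathbb R^n)$, and $$\big\|f\cdot\mathcal T_{\Omega,\alpha;m}(\vec g)\big\|_{WL^{r,\kappa}}\le C\,\|f\|_{L^{p,\kappa}}\prod_{i=1}^m\|g_i\|_{L^{p_i,\kappa}} .$$ -/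

import Mathlib

open MeasureTheory
open scoped ENNReal

noncomputable section

namespace OlsenMorrey

/-- The rotation invariant probability measure on the unit sphere of `ℝⁿ`: the surface measure
divided by its total mass. -/
def sphereMeasure (n : ℕ) : Measure (Metric.sphere (0 : EuclideanSpace ℝ (Fin n)) 1) :=
  ((volume : Measure (EuclideanSpace ℝ (Fin n))).toSphere Set.univ)⁻¹ •
    (volume : Measure (EuclideanSpace ℝ (Fin n))).toSphere

/-- `Ω` is homogeneous of degree zero on `ℝⁿ` and its restriction to the unit sphere
belongs to `L^s`. -/
structure IsRoughKernel {𝕜 : Type*} [RCLike 𝕜] {n : ℕ} (s : ℝ≥0∞)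
    (Ω : EuclideanSpace ℝ (Fin n) → 𝕜) : Prop where
  homogeneous : ∀ (t : ℝ), 0 < t → ∀ x : EuclideanSpace ℝ (Fin n), Ω (t • x) = Ω x
  memLp : MemLp (fun x : Metric.sphere (0 : EuclideanSpace ℝ (Fin n)) 1 => Ω x) s
    (sphereMeasure n)

/-- The Morrey norm `sup_B (m(B)^{-κ} ∫_B |f|^p)^{1/p}`, with values in `[0, ∞]`, the supremum
being over all open balls `B`. -/
def morreyNorm {𝕜 : Type*} [RCLike 𝕜] {n : ℕ} (p κ : ℝ)
    (f : EuclideanSpace ℝ (Fin n) → 𝕜) : ℝ≥0∞ :=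
  ⨆ (x₀ : EuclideanSpace ℝ (Fin n)) (ρ : ℝ) (_ : 0 < ρ),
    ((volume (Metric.ball x₀ ρ) ^ κ)⁻¹ * ∫⁻ x in Metric.ball x₀ ρ, ‖f x‖ₑ ^ p) ^ (1 / p)

/-- Membership in the Morrey space `L^{p,κ}(ℝⁿ)`. -/
def MemMorrey {𝕜 : Type*} [RCLike 𝕜] {n : ℕ} (p κ : ℝ)
    (f : EuclideanSpace ℝ (Fin n) → 𝕜) : Prop :=
  AEStronglyMeasurable f volume ∧ morreyNorm p κ f < ∞

/-- The weak Morrey norm `sup_B sup_{t>0} m(B)^{-κ/p} t m({x ∈ B : |f x| > t})^{1/p}`, with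
values in `[0, ∞]`, the supremum being over all open balls `B`. -/
def weakMorreyNorm {𝕜 : Type*} [RCLike 𝕜] {n : ℕ} (p κ : ℝ)
    (f : EuclideanSpace ℝ (Fin n) → 𝕜) : ℝ≥0∞ :=
  ⨆ (x₀ : EuclideanSpace ℝ (Fin n)) (ρ : ℝ) (_ : 0 < ρ) (t : ℝ) (_ : 0 < t),
    (volume (Metric.ball x₀ ρ) ^ (κ / p))⁻¹ *
      (ENNReal.ofReal t * volume {x | x ∈ Metric.ball x₀ ρ ∧ t < ‖f x‖} ^ (1 / p))

/-- Membership in the weak Morrey space `WL^{p,κ}(ℝⁿ)`. -/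
def MemWeakMorrey {𝕜 : Type*} [RCLike 𝕜] {n : ℕ} (p κ : ℝ)
    (f : EuclideanSpace ℝ (Fin n) → 𝕜) : Prop :=
  AEStronglyMeasurable f volume ∧ weakMorreyNorm p κ f < ∞

/-- The integrand, at the point `y = (y₁, …, y_m)` of `(ℝⁿ)^m`, of the multilinear fractional
integral with homogeneous kernels evaluated at `x`. -/
def fracIntegrand {𝕜 : Type*} [RCLike 𝕜] {n m : ℕ}
    (Ω : Fin m → EuclideanSpace ℝ (Fin n) → 𝕜) (α : ℝ)
    (g : Fin m → EuclideanSpace ℝ (Fin n) → 𝕜)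
    (x : EuclideanSpace ℝ (Fin n)) (y : Fin m → EuclideanSpace ℝ (Fin n)) : 𝕜 :=
  (∏ i, Ω i (x - y i)) /
      ((Real.sqrt (∑ j, ‖x - y j‖ ^ 2) ^ ((m : ℝ) * (n : ℝ) - α) : ℝ) : 𝕜) *
    ∏ i, g i (y i)

/-- The multilinear fractional integral with homogeneous kernels, an integral over `(ℝⁿ)^m`. -/
def fracIntegral {𝕜 : Type*} [RCLike 𝕜] {n m : ℕ}
    (Ω : Fin m → EuclideanSpace ℝ (Fin n) → 𝕜) (α : ℝ)
    (g : Fin m → EuclideanSpace ℝ (Fin n) → 𝕜) (x : EuclideanSpace ℝ (Fin n)) : 𝕜 :=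
  ∫ y : Fin m → EuclideanSpace ℝ (Fin n), fracIntegrand Ω α g x y

end OlsenMorrey

end

namespace OlsenMorrey

/-! The proof is Hedberg's method. Write t = s', S = ∑ 1/P_i and σ = 1/(qS), so 0 < σ < 1. Cut the
kernel dyadically according to the distance ϱ between y = (y_1, …, y_m) and (x, …, x). Where ϱ <
2^k, every y_i lies in B(x, 2^k), so Tonelli factors the k-th piece. Hölder's inequality absorbs
each Ω_i into its L^s norm, which scales exactly by homogeneity. What remains is at most a constant
times 2^{kα} times the product of the t-means of the g_i over B(x, 2^k).

Each t-mean has two bounds: the maximal function M_t g_i(x), and a negative power of the volume of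
the ball times the Morrey norm of g_i. The first makes the k-th piece grow like 2^{kα}; the second
makes it decay like 2^{-kβ} with β = n(1-κ)S - α = n(1-κ)/q > 0. Summing the smaller of the two
(`exists_tsum_min_geometric_le`) gives |T g| ≤ C (∏ M_t g_i)^σ (∏ ‖g_i‖)^{1-σ}, which is
`exists_lintegral_enorm_fracIntegrand_le`. The integral converges absolutely wherever the maximal
functions are finite.

Since 1/p + ∑ σ/P_i = 1/p + 1/q = 1/r, Hölder on a fixed ball then handles f together with the
maximal functions; all factors carry the same volume power m(B)^κ, so the answer does too. For P_i >
t the maximal function M_t is bounded on the Morrey space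
(`exists_setLIntegral_powerMaximal_rpow_le`). For P_i ≥ t there is the weak bound
`exists_rpow_mul_volume_lt_powerMaximal_le`, and Hölder is replaced by a union of level sets
(`rpow_mul_measure_lt_mul_prod_rpow_le`). -/

/-! ### Dyadic sums in `ℝ≥0∞`. -/

theorem exists_tsum_int_two_rpow_neg_abs_le {c : ℝ} (hc : 0 < c) :
    ∃ C : ℝ≥0∞, C ≠ ∞ ∧ ∀ y : ℝ, ∑' k : ℤ, (2 : ℝ≥0∞) ^ (-(c * |(k : ℝ) - y|)) ≤ C := by
  have hfin : ∑' j : ℤ, (2 : ℝ≥0∞) ^ (-(c * |(j : ℝ)|)) ≠ ∞ := by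
    have hr : (2 : ℝ≥0∞) ^ (-c) < 1 :=
      ENNReal.rpow_lt_one_of_one_lt_of_neg (by norm_num) (by linarith)
    have hgeom : ∑' j : ℕ, ((2 : ℝ≥0∞) ^ (-c)) ^ j ≠ ∞ := by
      rw [ENNReal.tsum_geometric, Ne, ENNReal.inv_eq_top, tsub_eq_zero_iff_le, not_le]
      exact hr
    rw [tsum_of_nat_of_neg_add_one ENNReal.summable ENNReal.summable]
    refine ENNReal.add_ne_top.2 ⟨?_, ?_⟩
    · convert hgeom using 3 with j
      rw [← ENNReal.rpow_natCast, ← ENNReal.rpow_mul]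
      simp
    · refine ne_top_of_le_ne_top hgeom (ENNReal.tsum_le_tsum fun j => ?_)
      rw [← ENNReal.rpow_natCast, ← ENNReal.rpow_mul]
      refine ENNReal.rpow_le_rpow_of_exponent_le (by norm_num) ?_
      push_cast
      rw [abs_neg, abs_of_nonneg (by positivity)]
      nlinarith
  refine ⟨2 ^ c * ∑' j : ℤ, (2 : ℝ≥0∞) ^ (-(c * |(j : ℝ)|)),
    ENNReal.mul_ne_top (ENNReal.rpow_ne_top_of_nonneg hc.le (by norm_num)) hfin, fun y => ?_⟩
  -- Shifting the index by ⌊y⌋ moves the centre into [0, 1); this costs the factor 2^c and makes the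
  -- bound uniform in y.
  rw [← (Equiv.addRight (⌊y⌋)).tsum_eq, ← ENNReal.tsum_mul_left]
  refine ENNReal.tsum_le_tsum fun j => ?_
  rw [← ENNReal.rpow_add _ _ (by norm_num) (by norm_num)]
  refine ENNReal.rpow_le_rpow_of_exponent_le (by norm_num) ?_
  have h1 := Int.floor_le y
  have h2 := Int.lt_floor_add_one y
  have : |(j : ℝ)| ≤ |((j + ⌊y⌋ : ℤ) : ℝ) - y| + 1 := by
    have e : (j : ℝ) = (((j + ⌊y⌋ : ℤ) : ℝ) - y) + (y - ⌊y⌋) := by push_cast; ring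
    calc |(j : ℝ)| ≤ |((j + ⌊y⌋ : ℤ) : ℝ) - y| + |y - ⌊y⌋| := by
          conv_lhs => rw [e]
          exact abs_add_le _ _
      _ ≤ _ := by
          gcongr
          rw [abs_le]
          constructor <;> linarith
  simp only [Equiv.coe_addRight]
  nlinarith

theorem exists_eq_two_rpow {x : ℝ≥0∞} (h0 : x ≠ 0) (h : x ≠ ∞) :
    ∃ y : ℝ, x = (2 : ℝ≥0∞) ^ y := by
  refine ⟨Real.logb 2 x.toReal, ?_⟩
  have hx := ENNReal.toReal_pos h0 h
  have : (2 : ℝ≥0∞) = ENNReal.ofReal 2 := by simp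
  rw [this, ENNReal.ofReal_rpow_of_pos (by norm_num),
    Real.rpow_logb (by norm_num) (by norm_num) hx, ENNReal.ofReal_toReal h]

/-- Summing the smaller of two geometric progressions, one increasing, one decreasing. -/
theorem exists_tsum_min_geometric_le {a b : ℝ} (ha : 0 < a) (hb : 0 < b) :
    ∃ C : ℝ≥0∞, C ≠ ∞ ∧ ∀ A B : ℝ≥0∞, B ≠ ∞ →
      ∑' k : ℤ, min ((2 : ℝ≥0∞) ^ (k * a) * A) (2 ^ (-(k * b)) * B) ≤
        C * (A ^ (b / (a + b)) * B ^ (a / (a + b))) := by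
  obtain ⟨C, hC, h⟩ := exists_tsum_int_two_rpow_neg_abs_le (lt_min ha hb)
  have hab : 0 < a + b := by positivity
  -- The added 1 keeps the constant nonzero, so that the right side is ∞ when A = ∞.
  refine ⟨C + 1, by simp [hC], fun A B hB => ?_⟩
  rcases eq_or_ne A 0 with rfl | hA0
  · simp
  rcases eq_or_ne B 0 with rfl | hB0
  · simp
  rcases eq_or_ne A ∞ with rfl | hA
  · rw [ENNReal.top_rpow_of_pos (by positivity), ENNReal.top_mul, ENNReal.mul_top]
    · exact le_top
    · simp
    · simp [hB0, hB]
  obtain ⟨u, rfl⟩ := exists_eq_two_rpow hA0 hA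
  obtain ⟨v, rfl⟩ := exists_eq_two_rpow hB0 hB
  have h2 : ∀ x y : ℝ, (2 : ℝ≥0∞) ^ x * 2 ^ y = 2 ^ (x + y) := fun x y =>
    (ENNReal.rpow_add _ _ (by norm_num) (by norm_num)).symm
  simp only [← ENNReal.rpow_mul, h2]
  -- With A = 2^u and B = 2^v, y is where the two progressions cross: u + ya = v - yb. The common
  -- value there is the claimed geometric mean, and the minimum decays from it on both sides at rate
  -- at least min a b.
  set y := (v - u) / (a + b) with hy
  have hyv : v = u + y * (a + b) := by rw [hy]; field_simp; ring
  calc _ ≤ ∑' k : ℤ, (2 : ℝ≥0∞) ^ (-(min a b * |(k : ℝ) - y|)) *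
        2 ^ (u * (b / (a + b)) + v * (a / (a + b))) := by
        refine ENNReal.tsum_le_tsum fun k => ?_
        have e : u * (b / (a + b)) + v * (a / (a + b)) = u + y * a := by
          rw [hyv]; field_simp; ring
        rw [h2, e]
        rcases le_total (k : ℝ) y with hk | hk
        · refine (min_le_left _ _).trans (ENNReal.rpow_le_rpow_of_exponent_le (by norm_num) ?_)
          rw [abs_of_nonpos (by linarith)]
          nlinarith [min_le_left a b]
        · refine (min_le_right _ _).trans (ENNReal.rpow_le_rpow_of_exponent_le (by norm_num) ?_)
          rw [abs_of_nonneg (by linarith), hyv]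
          nlinarith [min_le_right a b]
    _ ≤ _ := by
        rw [ENNReal.tsum_mul_right]
        gcongr
        exact (h y).trans le_self_add

/-- A dyadic sum of powers below a given height. -/
theorem exists_tsum_two_rpow_lt_le {a : ℝ} (ha : 0 < a) :
    ∃ C : ℝ≥0∞, C ≠ ∞ ∧ ∀ h : ℝ≥0∞,
      ∑' k : ℤ, (if (2 : ℝ≥0∞) ^ ((k : ℝ) - 1) < h then (2 : ℝ≥0∞) ^ (k * a) else 0) ≤
        C * h ^ a := by
  obtain ⟨C, hC, hs⟩ := exists_tsum_int_two_rpow_neg_abs_le ha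
  refine ⟨2 ^ (2 * a) * C + 1, ?_, fun h => ?_⟩
  · refine ENNReal.add_ne_top.2 ⟨ENNReal.mul_ne_top ?_ hC, by simp⟩
    exact ENNReal.rpow_ne_top_of_nonneg (by positivity) (by norm_num)
  rcases eq_or_ne h 0 with rfl | h0
  · simp
  rcases eq_or_ne h ∞ with rfl | hT
  · rw [ENNReal.top_rpow_of_pos ha, ENNReal.mul_top (by simp)]
    exact le_top
  obtain ⟨y, rfl⟩ := exists_eq_two_rpow h0 hT
  have h2 : ∀ x y : ℝ, (2 : ℝ≥0∞) ^ x * 2 ^ y = 2 ^ (x + y) := fun x y =>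
    (ENNReal.rpow_add _ _ (by norm_num) (by norm_num)).symm
  calc _ ≤ ∑' k : ℤ, (2 : ℝ≥0∞) ^ (2 * a + y * a) * (2 : ℝ≥0∞) ^ (-(a * |(k : ℝ) - y|)) := by
        refine ENNReal.tsum_le_tsum fun k => ?_
        split_ifs with hk
        · rw [h2]
          refine ENNReal.rpow_le_rpow_of_exponent_le (by norm_num) ?_
          have hk' : (k : ℝ) - 1 < y := by
            by_contra! hcon
            exact absurd (ENNReal.rpow_le_rpow_of_exponent_le (x := 2) (by norm_num) hcon)
              (not_le.2 hk)
          have : |(k : ℝ) - y| ≤ 2 - (k - y) := by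
            rw [abs_le]; constructor <;> linarith
          nlinarith
        · exact zero_le
    _ ≤ 2 ^ (2 * a + y * a) * C := by
        rw [ENNReal.tsum_mul_left]
        gcongr
        exact hs y
    _ = 2 ^ (2 * a) * C * (2 ^ y) ^ a := by
        rw [← h2, ENNReal.rpow_mul 2 y a]; ring
    _ ≤ _ := by gcongr; exact le_self_add

/-- A discrete layer-cake bound: for finite nonzero h the largest k with 2^k < h satisfies h ≤
2^{k+1}, so one term suffices. For h = ∞ infinitely many terms are at least 1. -/
theorem rpow_le_tsum_two_rpow_lt {u : ℝ} (hu : 0 < u) (h : ℝ≥0∞) :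
    h ^ u ≤ ∑' k : ℤ, (if (2 : ℝ≥0∞) ^ (k : ℝ) < h then (2 : ℝ≥0∞) ^ (((k : ℝ) + 1) * u) else 0) := by
  rcases eq_or_ne h 0 with rfl | h0
  · simp [hu]
  rcases eq_or_ne h ∞ with rfl | hT
  · rw [ENNReal.top_rpow_of_pos hu, top_le_iff]
    have h1 : ∀ k : ℤ, (2 : ℝ≥0∞) ^ (k : ℝ) < ∞ := fun k =>
      (ENNReal.rpow_ne_top_of_ne_zero (by norm_num) (by norm_num)).lt_top
    simp only [h1, if_true]
    rw [← top_le_iff]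
    calc (∞ : ℝ≥0∞) = ∑' _ : ℕ, 1 := by simp
      _ ≤ ∑' j : ℕ, (2 : ℝ≥0∞) ^ ((((j : ℤ) : ℝ) + 1) * u) := by
          refine ENNReal.tsum_le_tsum fun j => ?_
          refine ENNReal.one_le_rpow (by norm_num) ?_
          positivity
      _ ≤ _ := ENNReal.tsum_comp_le_tsum_of_injective Nat.cast_injective _
  obtain ⟨y, rfl⟩ := exists_eq_two_rpow h0 hT
  refine le_trans ?_ (ENNReal.le_tsum (⌈y⌉ - 1))
  have h1 := Int.le_ceil y
  have h2 := Int.ceil_lt_add_one y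
  rw [if_pos]
  · rw [← ENNReal.rpow_mul]
    refine ENNReal.rpow_le_rpow_of_exponent_le (by norm_num) ?_
    push_cast
    nlinarith
  · refine ENNReal.rpow_lt_rpow_of_exponent_lt (by norm_num) (by norm_num) ?_
    push_cast
    linarith

/-! ### The dyadic maximal function on Lebesgue spaces. -/

section Maximal

set_option linter.unusedSectionVars false

variable {E : Type*} [NormedAddCommGroup E] [NormedSpace ℝ E] [FiniteDimensional ℝ E]
  [MeasureSpace E] [BorelSpace E] [(volume : Measure E).IsAddHaarMeasure] [Nontrivial E]

theorem volume_ball_ne_zero (x : E) {R : ℝ} (hR : 0 < R) : volume (Metric.ball x R) ≠ 0 :=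
  (Metric.measure_ball_pos _ _ hR).ne'

theorem volume_ball_ne_top (x : E) (R : ℝ) : volume (Metric.ball x R) ≠ ∞ :=
  measure_ball_lt_top.ne

/-- The mean value of `h` over the ball of radius `R` about `x`. -/
noncomputable def ballMean (R : ℝ) (h : E → ℝ≥0∞) (x : E) : ℝ≥0∞ :=
  (volume (Metric.ball x R))⁻¹ * ∫⁻ y in Metric.ball x R, h y

/-- The centred maximal function over balls of dyadic radii. -/
noncomputable def dyadicMaximal (h : E → ℝ≥0∞) (x : E) : ℝ≥0∞ :=
  ⨆ k : ℤ, ballMean ((2 : ℝ) ^ k) h x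

theorem ballMean_congr_ae {h h' : E → ℝ≥0∞} (hh : h =ᵐ[volume] h') (R : ℝ) :
    ballMean R h = ballMean R h' := by
  funext x
  rw [ballMean, ballMean, lintegral_congr_ae (ae_restrict_of_ae hh)]

/-- The volume of the ball does not depend on its centre, and the integral is a parametrised
integral of a function jointly measurable in centre and variable, once h is replaced by a Borel
representative; the means do not see that change. -/
theorem measurable_ballMean (R : ℝ) {h : E → ℝ≥0∞} (hh : AEMeasurable h) :
    Measurable (ballMean R h) := by
  rw [ballMean_congr_ae hh.ae_eq_mk]
  have hm : Measurable fun z : E × E => (Metric.ball (0 : E) R).indicator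
      (fun _ => hh.mk h z.2) (z.2 - z.1) := by
    have : (fun z : E × E => (Metric.ball (0 : E) R).indicator
        (fun _ => hh.mk h z.2) (z.2 - z.1)) =
        {z : E × E | z.2 - z.1 ∈ Metric.ball (0 : E) R}.indicator (fun z => hh.mk h z.2) := by
      funext z; simp [Set.indicator]
    rw [this]
    refine (hh.measurable_mk.comp measurable_snd).indicator ?_
    exact (measurable_snd.sub measurable_fst) measurableSet_ball
  have := hm.lintegral_prod_right' (ν := (volume : Measure E))
  convert this.const_mul (volume (Metric.ball (0 : E) R))⁻¹ using 1
  funext x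
  rw [ballMean, Measure.addHaar_ball_center, ← lintegral_indicator measurableSet_ball]
  congr 2
  funext y
  simp [Set.indicator, dist_eq_norm]

theorem measurable_dyadicMaximal {h : E → ℝ≥0∞} (hh : AEMeasurable h) :
    Measurable (dyadicMaximal h) :=
  Measurable.iSup fun _ => measurable_ballMean _ hh

/-- The weak type `(1, 1)` inequality, for balls of bounded radius. -/
theorem mul_volume_setOf_lt_ballMean_le (h : E → ℝ≥0∞) (K : ℤ) (l : ℝ≥0∞) :
    l * volume {x : E | ∃ k : ℤ, k ≤ K ∧ l < ballMean ((2 : ℝ) ^ k) h x} ≤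
      5 ^ (Module.finrank ℝ E) * ∫⁻ y, h y := by
  set S : Set E := {x : E | ∃ k : ℤ, k ≤ K ∧ l < ballMean ((2 : ℝ) ^ k) h x} with hS
  choose! k hkK hk using fun x (hx : x ∈ S) => hx
  -- The cap k ≤ K supplies the bounded radii that Vitali's covering lemma requires. No
  -- integrability of h is needed.
  obtain ⟨u, huS, hdisj, hcov⟩ := Vitali.exists_disjoint_subfamily_covering_enlargement_closedBall
    S id (fun x => (2 : ℝ) ^ (k x)) ((2 : ℝ) ^ K)
    (fun a ha => zpow_le_zpow_right₀ (by norm_num) (hkK a ha)) 5 (by norm_num)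
  have hpos : ∀ x, (0 : ℝ) < 2 ^ k x := fun x => by positivity
  have hcount : u.Countable := by
    refine hdisj.countable_of_nonempty_interior fun a _ => ?_
    exact ⟨a, Metric.ball_subset_interior_closedBall (Metric.mem_ball_self (hpos a))⟩
  have hmean : ∀ a ∈ u, l * volume (Metric.ball a ((2 : ℝ) ^ k a)) ≤
      ∫⁻ y in Metric.ball a ((2 : ℝ) ^ k a), h y := fun a ha => by
    have := (hk a (huS ha)).le
    rw [ballMean, mul_comm, ← div_eq_mul_inv, ENNReal.le_div_iff_mul_le
      (Or.inl (volume_ball_ne_zero _ (hpos a))) (Or.inl (volume_ball_ne_top _ _))] at this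
    exact this
  have hvol : ∀ a, volume (Metric.closedBall a (5 * (2 : ℝ) ^ k a)) =
      5 ^ (Module.finrank ℝ E) * volume (Metric.ball a ((2 : ℝ) ^ k a)) := fun a => by
    rw [Measure.addHaar_closedBall_mul _ _ (by norm_num) (hpos a).le,
      Measure.addHaar_closedBall_eq_addHaar_ball, Measure.addHaar_ball_center _ a]
    congr 1
    rw [ENNReal.ofReal_pow (by norm_num)]
    simp
  calc l * volume S ≤ l * volume (⋃ a ∈ u, Metric.closedBall a (5 * (2 : ℝ) ^ k a)) := by
        gcongr
        intro x hx
        obtain ⟨b, hb, hsub⟩ := hcov x hx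
        exact Set.mem_biUnion hb (hsub (Metric.mem_closedBall_self (hpos x).le))
    _ ≤ l * ∑' a : u, volume (Metric.closedBall (a : E) (5 * (2 : ℝ) ^ k a)) := by
        gcongr
        exact measure_biUnion_le _ hcount _
    _ = 5 ^ (Module.finrank ℝ E) * ∑' a : u, l * volume (Metric.ball (a : E) ((2 : ℝ) ^ k a)) := by
        simp_rw [hvol]
        rw [ENNReal.tsum_mul_left, ENNReal.tsum_mul_left]
        ring
    _ ≤ 5 ^ (Module.finrank ℝ E) * ∑' a : u, ∫⁻ y in Metric.ball (a : E) ((2 : ℝ) ^ k a), h y := by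
        gcongr with a
        exact hmean a a.2
    _ = 5 ^ (Module.finrank ℝ E) * ∫⁻ y in ⋃ a ∈ u, Metric.ball a ((2 : ℝ) ^ k a), h y := by
        rw [lintegral_biUnion hcount (fun _ _ => measurableSet_ball)]
        exact hdisj.mono fun a => Metric.ball_subset_closedBall
    _ ≤ _ := by
        exact mul_le_mul' le_rfl (setLIntegral_le_lintegral _ _)

theorem ballMean_mono {h h' : E → ℝ≥0∞} (hh : ∀ y, h y ≤ h' y) (R : ℝ) (x : E) :
    ballMean R h x ≤ ballMean R h' x := by
  unfold ballMean
  gcongr with y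
  exact hh y

/-- The part of h below height l contributes at most l to any mean. Hence a mean above 2l forces the
mean of the tall part above l, the truncation used for interpolation. -/
theorem ballMean_le_add {h : E → ℝ≥0∞} (hh : Measurable h) (l : ℝ≥0∞) {R : ℝ} (hR : 0 < R)
    (x : E) :
    ballMean R h x ≤ ballMean R ({y | l < h y}.indicator h) x + l := by
  have hs : MeasurableSet {y | l < h y} := measurableSet_lt measurable_const hh
  calc ballMean R h x ≤ ballMean R (fun y => {y | l < h y}.indicator h y + l) x := by
        refine ballMean_mono (fun y => ?_) R x
        by_cases hy : l < h y
        · rw [Set.indicator_of_mem (by exact hy)]; exact le_self_add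
        · exact (not_lt.1 hy).trans le_add_self
    _ = _ := by
        unfold ballMean
        rw [lintegral_add_left (hh.indicator hs), mul_add]
        congr 1
        rw [setLIntegral_const, mul_left_comm,
          ENNReal.inv_mul_cancel (volume_ball_ne_zero _ hR) (volume_ball_ne_top _ _), mul_one]

/-- The maximal function over radii `2 ^ k`, `k ≤ K`, is bounded on `L^u`, uniformly in `K`. -/
theorem exists_lintegral_iSup_ballMean_rpow_le (E : Type*) [NormedAddCommGroup E]
    [NormedSpace ℝ E] [FiniteDimensional ℝ E]
    [MeasureSpace E] [BorelSpace E] [(volume : Measure E).IsAddHaarMeasure] [Nontrivial E]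
    {u : ℝ} (hu : 1 < u) :
    ∃ C : ℝ≥0∞, C ≠ ∞ ∧ ∀ (h : E → ℝ≥0∞), Measurable h → ∀ K : ℤ,
      ∫⁻ x, (⨆ (k : ℤ) (_ : k ≤ K), ballMean ((2 : ℝ) ^ k) h x) ^ u ≤ C * ∫⁻ y, h y ^ u := by
  obtain ⟨C, hC, hsum⟩ := exists_tsum_two_rpow_lt_le (a := u - 1) (by linarith)
  refine ⟨2 ^ (u + 1) * 5 ^ (Module.finrank ℝ E) * C, ?_, fun h hh K => ?_⟩
  · refine ENNReal.mul_ne_top (ENNReal.mul_ne_top ?_ ?_) hC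
    · exact ENNReal.rpow_ne_top_of_nonneg (by linarith) (by norm_num)
    · exact ENNReal.pow_ne_top (by norm_num)
  set N : E → ℝ≥0∞ := fun x => ⨆ (k : ℤ) (_ : k ≤ K), ballMean ((2 : ℝ) ^ k) h x with hN
  have hNm : Measurable N := Measurable.iSup fun k => Measurable.iSup fun _ =>
    measurable_ballMean _ hh.aemeasurable
  have h2 : ∀ x y : ℝ, (2 : ℝ≥0∞) ^ x * 2 ^ y = 2 ^ (x + y) := fun x y =>
    (ENNReal.rpow_add _ _ (by norm_num) (by norm_num)).symm
  -- Marcinkiewicz interpolation: at level 2^k only the part of h above 2^{k-1} matters, and the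
  -- weak (1, 1) inequality applies to it at height 2^{k-1}.
  have hlevel : ∀ k : ℤ, (2 : ℝ≥0∞) ^ ((k : ℝ) - 1) * volume {x | (2 : ℝ≥0∞) ^ (k : ℝ) < N x} ≤
      5 ^ (Module.finrank ℝ E) *
        ∫⁻ y, {y | (2 : ℝ≥0∞) ^ ((k : ℝ) - 1) < h y}.indicator h y := fun k => by
    refine le_trans ?_ (mul_volume_setOf_lt_ballMean_le _ K ((2 : ℝ≥0∞) ^ ((k : ℝ) - 1)))
    refine mul_le_mul' le_rfl (measure_mono fun x hx => ?_)
    simp only [hN, Set.mem_ofPred_eq, lt_iSup_iff] at hx ⊢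
    obtain ⟨j, hj, hx⟩ := hx
    refine ⟨j, hj, ?_⟩
    have h3 := hx.trans_le (ballMean_le_add hh ((2 : ℝ≥0∞) ^ ((k : ℝ) - 1))
      (by positivity : (0 : ℝ) < 2 ^ j) x)
    have h4 : (2 : ℝ≥0∞) ^ (k : ℝ) = 2 ^ ((k : ℝ) - 1) + 2 ^ ((k : ℝ) - 1) := by
      rw [← two_mul]
      nth_rewrite 2 [← ENNReal.rpow_one 2]
      rw [h2]
      ring_nf
    rw [h4] at h3
    exact lt_of_add_lt_add_right h3
  calc ∫⁻ x, N x ^ u ≤ ∫⁻ x, ∑' k : ℤ, (if (2 : ℝ≥0∞) ^ (k : ℝ) < N x then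
          (2 : ℝ≥0∞) ^ (((k : ℝ) + 1) * u) else 0) :=
        lintegral_mono fun x => rpow_le_tsum_two_rpow_lt (by linarith) (N x)
    _ = ∑' k : ℤ, (2 : ℝ≥0∞) ^ (((k : ℝ) + 1) * u) * volume {x | (2 : ℝ≥0∞) ^ (k : ℝ) < N x} := by
        rw [lintegral_tsum]
        · refine tsum_congr fun k => ?_
          rw [← lintegral_indicator_const (measurableSet_lt measurable_const hNm)]
          exact lintegral_congr fun x => by simp [Set.indicator]
        · exact fun k => (Measurable.ite (measurableSet_lt measurable_const hNm)
            measurable_const measurable_const).aemeasurable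
    _ = ∑' k : ℤ, (2 : ℝ≥0∞) ^ (u + 1) * 2 ^ ((k : ℝ) * (u - 1)) *
          (2 ^ ((k : ℝ) - 1) * volume {x | (2 : ℝ≥0∞) ^ (k : ℝ) < N x}) := by
        refine tsum_congr fun k => ?_
        rw [h2, ← mul_assoc, h2]
        ring_nf
    _ ≤ ∑' k : ℤ, (2 : ℝ≥0∞) ^ (u + 1) * 2 ^ ((k : ℝ) * (u - 1)) * (5 ^ (Module.finrank ℝ E) *
        ∫⁻ y, {y | (2 : ℝ≥0∞) ^ ((k : ℝ) - 1) < h y}.indicator h y) := by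
        exact ENNReal.tsum_le_tsum fun k => mul_le_mul' le_rfl (hlevel k)
    _ = (2 : ℝ≥0∞) ^ (u + 1) * 5 ^ (Module.finrank ℝ E) * ∑' k : ℤ, 2 ^ ((k : ℝ) * (u - 1)) *
        ∫⁻ y, {y | (2 : ℝ≥0∞) ^ ((k : ℝ) - 1) < h y}.indicator h y := by
        rw [← ENNReal.tsum_mul_left]
        refine tsum_congr fun k => ?_
        ring
    -- After the exchange of sum and integral, the levels active at y satisfy 2^{k-1} < h y. Since u
    -- - 1 > 0, their powers sum to a multiple of h(y)^{u-1}.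
    _ = (2 : ℝ≥0∞) ^ (u + 1) * 5 ^ (Module.finrank ℝ E) * ∫⁻ y, h y * ∑' k : ℤ,
        (if (2 : ℝ≥0∞) ^ ((k : ℝ) - 1) < h y then (2 : ℝ≥0∞) ^ (k * (u - 1)) else 0) := by
        congr 1
        simp_rw [← ENNReal.tsum_mul_left]
        rw [lintegral_tsum]
        · refine tsum_congr fun k => ?_
          rw [← lintegral_const_mul _ (hh.indicator (measurableSet_lt measurable_const hh))]
          refine lintegral_congr fun y => ?_
          by_cases hy : (2 : ℝ≥0∞) ^ ((k : ℝ) - 1) < h y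
          · rw [Set.indicator_of_mem (by exact hy), if_pos hy, mul_comm]
          · rw [Set.indicator_of_notMem (by exact hy), if_neg hy, mul_zero, mul_zero]
        · exact fun k => (hh.mul (Measurable.ite (measurableSet_lt measurable_const hh)
            measurable_const measurable_const)).aemeasurable
    _ ≤ (2 : ℝ≥0∞) ^ (u + 1) * 5 ^ (Module.finrank ℝ E) * ∫⁻ y, C * h y ^ u := by
        refine mul_le_mul' le_rfl (lintegral_mono fun y => ?_)
        calc _ ≤ h y * (C * h y ^ (u - 1)) := mul_le_mul' le_rfl (hsum (h y))
          _ = C * h y ^ u := by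
              have : h y ^ u = h y ^ (1 : ℝ) * h y ^ (u - 1) := by
                rw [← ENNReal.rpow_add_of_nonneg _ _ (by norm_num) (by linarith)]
                ring_nf
              rw [this, ENNReal.rpow_one]; ring
    _ = _ := by
        rw [lintegral_const_mul _ (hh.pow_const u)]; ring

end Maximal

/-! ### The dyadic maximal function on Morrey spaces. -/

section MaximalMorrey

set_option linter.unusedSectionVars false

variable {E : Type*} [NormedAddCommGroup E] [NormedSpace ℝ E] [FiniteDimensional ℝ E]
  [MeasureSpace E] [BorelSpace E] [(volume : Measure E).IsAddHaarMeasure] [Nontrivial E]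

/-- Jensen's inequality, obtained from the monotonicity of L^p norms for the normalised measure on
the ball. -/
theorem ballMean_rpow_le {u : ℝ} (hu : 1 ≤ u) {h : E → ℝ≥0∞} (hh : AEMeasurable h) {R : ℝ}
    (hR : 0 < R) (x : E) :
    ballMean R h x ^ u ≤ ballMean R (fun y => h y ^ u) x := by
  set μ : Measure E := (volume (Metric.ball x R))⁻¹ • volume.restrict (Metric.ball x R) with hμ
  have : IsProbabilityMeasure μ := ⟨by
    rw [hμ, Measure.smul_apply, Measure.restrict_apply_univ, smul_eq_mul,
      ENNReal.inv_mul_cancel (volume_ball_ne_zero _ hR) (volume_ball_ne_top _ _)]⟩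
  have hm : AEStronglyMeasurable h μ :=
    (hh.aestronglyMeasurable.restrict).mono_ac Measure.smul_absolutelyContinuous
  have key := eLpNorm'_le_eLpNorm'_of_exponent_le (μ := μ) (p := 1) (q := u) (by norm_num) hu hm
  simp only [eLpNorm', enorm_eq_self, ENNReal.rpow_one, div_one] at key
  rw [one_div, ENNReal.le_rpow_inv_iff (by linarith)] at key
  simpa only [ballMean, hμ, lintegral_smul_measure, smul_eq_mul] using key

theorem ballMean_rpow_le_of_morrey {u κ : ℝ} (hu : 1 ≤ u) {h : E → ℝ≥0∞} (hh : AEMeasurable h)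
    {N : ℝ≥0∞}
    (hN : ∀ (x : E) (R : ℝ), 0 < R →
      ∫⁻ y in Metric.ball x R, h y ^ u ≤ N * volume (Metric.ball x R) ^ κ)
    {R : ℝ} (hR : 0 < R) (x : E) :
    ballMean R h x ^ u ≤ N * volume (Metric.ball x R) ^ (κ - 1) := by
  refine (ballMean_rpow_le hu hh hR x).trans ?_
  calc _ ≤ (volume (Metric.ball x R))⁻¹ * (N * volume (Metric.ball x R) ^ κ) := by
        unfold ballMean
        gcongr
        exact hN x R hR
    _ = _ := by
        rw [ENNReal.rpow_sub _ _ (volume_ball_ne_zero _ hR) (volume_ball_ne_top _ _),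
          ENNReal.rpow_one, div_eq_mul_inv]
        ring

theorem volume_ball_rpow_antitone {κ : ℝ} (hκ : κ ≤ 0) (x y : E) {R R' : ℝ} (hR : R ≤ R') :
    volume (Metric.ball x R') ^ κ ≤ volume (Metric.ball y R) ^ κ := by
  obtain ⟨a, rfl⟩ : ∃ a, κ = -a := ⟨-κ, by simp⟩
  rw [ENNReal.rpow_neg, ENNReal.rpow_neg, ENNReal.inv_le_inv]
  refine ENNReal.rpow_le_rpow ?_ (by linarith)
  rw [Measure.addHaar_ball_center _ x, Measure.addHaar_ball_center _ y]
  exact measure_mono (Metric.ball_subset_ball hR)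

theorem volume_ball_two_mul (x : E) (R : ℝ) :
    volume (Metric.ball x (2 * R)) = 2 ^ (Module.finrank ℝ E) * volume (Metric.ball x R) := by
  rw [Measure.addHaar_ball_mul _ _ (by norm_num : (0 : ℝ) ≤ 2), Measure.addHaar_ball_center _ x,
    ENNReal.ofReal_pow (by norm_num)]
  simp

theorem ballMean_indicator_eq {h : E → ℝ≥0∞} {s : Set E} (hs : MeasurableSet s) {R : ℝ} {x : E}
    (hsub : Metric.ball x R ⊆ s) : ballMean R (s.indicator h) x = ballMean R h x := by
  unfold ballMean
  rw [lintegral_indicator hs, Measure.restrict_restrict hs, Set.inter_eq_self_of_subset_right hsub]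

/-- The split of the maximal function into a local part and a part of large radii. -/
theorem ballMean_local_or_morrey {u κ : ℝ} (hu : 1 ≤ u) (hκ : κ ≤ 1) {h : E → ℝ≥0∞}
    (hh : AEMeasurable h) {N : ℝ≥0∞}
    (hN : ∀ (x : E) (R : ℝ), 0 < R →
      ∫⁻ y in Metric.ball x R, h y ^ u ≤ N * volume (Metric.ball x R) ^ κ)
    {ρ : ℝ} (x₀ : E) {K : ℤ} (hK : (2 : ℝ) ^ K ≤ ρ) (hK' : ρ < 2 ^ (K + 1))
    {x : E} (hx : x ∈ Metric.ball x₀ ρ) (k : ℤ) :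
    (k ≤ K ∧ ballMean (2 ^ k) h x =
      ballMean (2 ^ k) ((Metric.ball x₀ (2 * ρ)).indicator h) x) ∨
      ballMean (2 ^ k) h x ^ u ≤ N * volume (Metric.ball x₀ ρ) ^ (κ - 1) := by
  -- A radius 2^k ≤ ρ keeps the ball about x inside B(x₀, 2ρ), so truncating h changes nothing. A
  -- larger radius exceeds ρ, and the Morrey bound at that radius is no worse than the one at radius
  -- ρ because κ ≤ 1.
  rcases le_or_gt k K with hk | hk
  · refine Or.inl ⟨hk, (ballMean_indicator_eq measurableSet_ball ?_).symm⟩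
    have : (2 : ℝ) ^ k ≤ ρ := (zpow_le_zpow_right₀ (by norm_num) hk).trans hK
    refine Metric.ball_subset_ball' ?_
    have := Metric.mem_ball.1 hx
    linarith
  · right
    have : ρ ≤ (2 : ℝ) ^ k := hK'.le.trans (zpow_le_zpow_right₀ (by norm_num) hk)
    refine (ballMean_rpow_le_of_morrey hu hh hN (by positivity : (0 : ℝ) < 2 ^ k) x).trans ?_
    exact mul_le_mul' le_rfl (volume_ball_rpow_antitone (by linarith) _ _ this)

theorem setLIntegral_two_ball_le_of_morrey {u κ : ℝ} (hκ : 0 ≤ κ) {h : E → ℝ≥0∞} {N : ℝ≥0∞}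
    (hN : ∀ (x : E) (R : ℝ), 0 < R →
      ∫⁻ y in Metric.ball x R, h y ^ u ≤ N * volume (Metric.ball x R) ^ κ)
    (x : E) {R : ℝ} (hR : 0 < R) :
    ∫⁻ y in Metric.ball x (2 * R), h y ^ u ≤
      (2 ^ (Module.finrank ℝ E)) ^ κ * (N * volume (Metric.ball x R) ^ κ) := by
  refine (hN x (2 * R) (by positivity)).trans (le_of_eq ?_)
  rw [volume_ball_two_mul x R, ENNReal.mul_rpow_of_nonneg _ _ hκ]
  ring

variable (E) in
/-- The maximal function is bounded on Morrey spaces. -/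
theorem exists_setLIntegral_dyadicMaximal_rpow_le {u κ : ℝ} (hu : 1 < u) (hκ₀ : 0 ≤ κ)
    (hκ₁ : κ ≤ 1) :
    ∃ C : ℝ≥0∞, C ≠ ∞ ∧ ∀ (h : E → ℝ≥0∞), Measurable h → ∀ N : ℝ≥0∞,
      (∀ (x : E) (R : ℝ), 0 < R →
        ∫⁻ y in Metric.ball x R, h y ^ u ≤ N * volume (Metric.ball x R) ^ κ) →
      ∀ (x : E) (R : ℝ), 0 < R →
        ∫⁻ y in Metric.ball x R, dyadicMaximal h y ^ u ≤
          C * (N * volume (Metric.ball x R) ^ κ) := by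
  obtain ⟨C, hC, hmax⟩ := exists_lintegral_iSup_ballMean_rpow_le E hu
  -- The first summand pays for the small radii, through the doubled ball; the 1 pays for the large
  -- ones.
  refine ⟨C * (2 ^ (Module.finrank ℝ E)) ^ κ + 1, ?_, fun h hh N hN x₀ ρ hρ => ?_⟩
  · refine ENNReal.add_ne_top.2 ⟨ENNReal.mul_ne_top hC ?_, by simp⟩
    exact ENNReal.rpow_ne_top_of_nonneg hκ₀ (ENNReal.pow_ne_top (by norm_num))
  obtain ⟨K, hK, hK'⟩ := exists_mem_Ico_zpow hρ (one_lt_two : (1 : ℝ) < 2)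
  set h₁ := (Metric.ball x₀ (2 * ρ)).indicator h with hh₁
  have hm₁ : Measurable h₁ := hh.indicator measurableSet_ball
  have hu0 : 0 < u := by linarith
  calc ∫⁻ y in Metric.ball x₀ ρ, dyadicMaximal h y ^ u
      ≤ ∫⁻ y in Metric.ball x₀ ρ, ((⨆ (k : ℤ) (_ : k ≤ K), ballMean ((2 : ℝ) ^ k) h₁ y) ^ u +
          N * volume (Metric.ball x₀ ρ) ^ (κ - 1)) := by
        refine setLIntegral_mono' measurableSet_ball fun x hx => ?_
        rw [← ENNReal.le_rpow_inv_iff hu0]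
        refine iSup_le fun k => ?_
        rw [ENNReal.le_rpow_inv_iff hu0]
        rcases ballMean_local_or_morrey hu.le hκ₁ hh.aemeasurable hN x₀ hK hK' hx k with
          ⟨hk, he⟩ | he
        · rw [he]
          refine le_trans ?_ le_self_add
          gcongr
          exact le_iSup₂_of_le k hk le_rfl
        · exact he.trans le_add_self
    _ = (∫⁻ y in Metric.ball x₀ ρ,
          (⨆ (k : ℤ) (_ : k ≤ K), ballMean ((2 : ℝ) ^ k) h₁ y) ^ u) +
          N * volume (Metric.ball x₀ ρ) ^ κ := by
        rw [lintegral_add_right _ measurable_const, setLIntegral_const]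
        congr 1
        rw [ENNReal.rpow_sub _ _ (volume_ball_ne_zero _ hρ) (volume_ball_ne_top _ _),
          ENNReal.rpow_one, mul_assoc,
          ENNReal.div_mul_cancel (volume_ball_ne_zero _ hρ) (volume_ball_ne_top _ _)]
    _ ≤ C * (∫⁻ y, h₁ y ^ u) + N * volume (Metric.ball x₀ ρ) ^ κ := by
        gcongr
        exact (setLIntegral_le_lintegral _ _).trans (hmax h₁ hm₁ K)
    _ = C * (∫⁻ y in Metric.ball x₀ (2 * ρ), h y ^ u) + N * volume (Metric.ball x₀ ρ) ^ κ := by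
        rw [← lintegral_indicator measurableSet_ball]
        congr 3
        funext y
        by_cases hy : y ∈ Metric.ball x₀ (2 * ρ)
        · rw [hh₁, Set.indicator_of_mem hy, Set.indicator_of_mem hy]
        · rw [hh₁, Set.indicator_of_notMem hy, Set.indicator_of_notMem hy,
            ENNReal.zero_rpow_of_pos hu0]
    _ ≤ C * ((2 ^ (Module.finrank ℝ E)) ^ κ * (N * volume (Metric.ball x₀ ρ) ^ κ)) +
          N * volume (Metric.ball x₀ ρ) ^ κ := by
        gcongr
        exact setLIntegral_two_ball_le_of_morrey hκ₀ hN x₀ hρ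
    _ = _ := by ring

variable (E) in
/-- The weak type inequality of the maximal function on Morrey spaces. -/
theorem exists_mul_volume_lt_dyadicMaximal_le {κ : ℝ} (hκ₀ : 0 ≤ κ) (hκ₁ : κ ≤ 1) :
    ∃ C : ℝ≥0∞, C ≠ ∞ ∧ ∀ (h : E → ℝ≥0∞), Measurable h → ∀ N : ℝ≥0∞,
      (∀ (x : E) (R : ℝ), 0 < R →
        ∫⁻ y in Metric.ball x R, h y ≤ N * volume (Metric.ball x R) ^ κ) →
      ∀ (x : E) (R : ℝ), 0 < R → ∀ l : ℝ≥0∞,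
        l * volume {y | y ∈ Metric.ball x R ∧ l < dyadicMaximal h y} ≤
          C * (N * volume (Metric.ball x R) ^ κ) := by
  refine ⟨5 ^ (Module.finrank ℝ E) * (2 ^ (Module.finrank ℝ E)) ^ κ + 1, ?_,
    fun h hh N hN x₀ ρ hρ l => ?_⟩
  · refine ENNReal.add_ne_top.2 ⟨ENNReal.mul_ne_top (ENNReal.pow_ne_top (by norm_num)) ?_, by simp⟩
    exact ENNReal.rpow_ne_top_of_nonneg hκ₀ (ENNReal.pow_ne_top (by norm_num))
  obtain ⟨K, hK, hK'⟩ := exists_mem_Ico_zpow hρ (one_lt_two : (1 : ℝ) < 2)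
  set h₁ := (Metric.ball x₀ (2 * ρ)).indicator h with hh₁
  have hN1 : ∀ (x : E) (R : ℝ), 0 < R →
        ∫⁻ y in Metric.ball x R, h y ^ (1 : ℝ) ≤ N * volume (Metric.ball x R) ^ κ := by
    simpa only [ENNReal.rpow_one] using hN
  -- Below this threshold the volume of the whole ball is a good enough bound. Above it the large
  -- radii cannot produce a mean exceeding l, so only the truncated function counts.
  rcases le_or_gt l (N * volume (Metric.ball x₀ ρ) ^ (κ - 1)) with hl | hl
  · calc l * volume {y | y ∈ Metric.ball x₀ ρ ∧ l < dyadicMaximal h y}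
        ≤ N * volume (Metric.ball x₀ ρ) ^ (κ - 1) * volume (Metric.ball x₀ ρ) := by
          gcongr
          exact fun y hy => hy.1
      _ = 1 * (N * volume (Metric.ball x₀ ρ) ^ κ) := by
          rw [ENNReal.rpow_sub _ _ (volume_ball_ne_zero _ hρ) (volume_ball_ne_top _ _),
            ENNReal.rpow_one, mul_assoc,
            ENNReal.div_mul_cancel (volume_ball_ne_zero _ hρ) (volume_ball_ne_top _ _), one_mul]
      _ ≤ _ := by gcongr; exact le_add_self
  · calc l * volume {y | y ∈ Metric.ball x₀ ρ ∧ l < dyadicMaximal h y}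
        ≤ l * volume {x : E | ∃ k : ℤ, k ≤ K ∧ l < ballMean ((2 : ℝ) ^ k) h₁ x} := by
          gcongr 1
          refine measure_mono fun y hy => ?_
          obtain ⟨hy, hly⟩ := hy
          obtain ⟨k, hk⟩ := lt_iSup_iff.1 hly
          rcases ballMean_local_or_morrey le_rfl hκ₁ hh.aemeasurable hN1 x₀ hK hK' hy k with
            ⟨hkK, he⟩ | he
          · exact ⟨k, hkK, he ▸ hk⟩
          · rw [ENNReal.rpow_one] at he
            exact absurd (he.trans hl.le) (not_le.2 hk)
      _ ≤ 5 ^ (Module.finrank ℝ E) * ∫⁻ y, h₁ y := mul_volume_setOf_lt_ballMean_le _ _ _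
      _ = 5 ^ (Module.finrank ℝ E) * ∫⁻ y in Metric.ball x₀ (2 * ρ), h y ^ (1 : ℝ) := by
          rw [hh₁, lintegral_indicator measurableSet_ball]
          simp only [ENNReal.rpow_one]
      _ ≤ 5 ^ (Module.finrank ℝ E) *
            ((2 ^ (Module.finrank ℝ E)) ^ κ * (N * volume (Metric.ball x₀ ρ) ^ κ)) := by
          gcongr
          exact setLIntegral_two_ball_le_of_morrey hκ₀ hN1 x₀ hρ
      _ = 5 ^ (Module.finrank ℝ E) * (2 ^ (Module.finrank ℝ E)) ^ κ *
            (N * volume (Metric.ball x₀ ρ) ^ κ) := by ring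
      _ ≤ _ := by gcongr; exact le_self_add

end MaximalMorrey

/-! ### Homogeneous kernels, Hölder's inequality and Tonelli's theorem. -/

section Kernel

set_option linter.unusedSectionVars false

variable {E : Type*} [NormedAddCommGroup E] [NormedSpace ℝ E] [FiniteDimensional ℝ E]
  [MeasureSpace E] [BorelSpace E] [(volume : Measure E).IsAddHaarMeasure] [Nontrivial E]
  {𝕜 : Type*} [NormedField 𝕜]

/-- In polar coordinates Ω depends on the spherical variable alone; this transfers measurability and
integrability from the sphere to the space. -/
theorem eq_comp_homeomorphUnitSphereProd {Ω : E → 𝕜}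
    (hΩ : ∀ t : ℝ, 0 < t → ∀ x : E, Ω (t • x) = Ω x) :
    Ω ∘ (Subtype.val : ({0}ᶜ : Set E) → E) =
      (fun z : Metric.sphere (0 : E) 1 × Set.Ioi (0 : ℝ) => Ω z.1) ∘ homeomorphUnitSphereProd E := by
  funext x
  have hx : 0 < ‖(x : E)‖⁻¹ := inv_pos.2 (norm_pos_iff.2 x.2)
  simp [hΩ _ hx]

/-- A function homogeneous of degree zero is measurable if its restriction to the sphere is. -/
theorem aestronglyMeasurable_of_homogeneous {Ω : E → 𝕜}
    (hΩ : ∀ t : ℝ, 0 < t → ∀ x : E, Ω (t • x) = Ω x)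
    (hm : AEStronglyMeasurable (fun x : Metric.sphere (0 : E) 1 => Ω x)
      (volume : Measure E).toSphere) : AEStronglyMeasurable Ω (volume : Measure E) := by
  have hs : MeasurableSet ({0}ᶜ : Set E) := (measurableSet_singleton _).compl
  rw [← restrict_compl_singleton (μ := (volume : Measure E)) 0, ← map_comap_subtype_coe hs,
    (MeasurableEmbedding.subtype_coe hs).aestronglyMeasurable_map_iff,
    eq_comp_homeomorphUnitSphereProd hΩ]
  exact hm.comp_fst.comp_measurePreserving
    (volume : Measure E).measurePreserving_homeomorphUnitSphereProd

/-- A function homogeneous of degree zero is in `L^s` of the unit ball if it is in `L^s` of the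
sphere. -/
theorem memLp_ball_of_homogeneous {Ω : E → 𝕜} {s : ℝ≥0∞}
    (hΩ : ∀ t : ℝ, 0 < t → ∀ x : E, Ω (t • x) = Ω x)
    (hm : MemLp (fun x : Metric.sphere (0 : E) 1 => Ω x) s (volume : Measure E).toSphere) :
    MemLp Ω s (volume.restrict (Metric.ball (0 : E) 1)) := by
  have hs : MeasurableSet ({0}ᶜ : Set E) := (measurableSet_singleton _).compl
  set I : Set (Set.Ioi (0 : ℝ)) := Set.Iio ⟨1, Set.mem_Ioi.2 one_pos⟩ with hI
  -- The radial measure of (0, 1) is finite, so a function of the spherical variable stays in L^s on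
  -- the product.
  have hfin : IsFiniteMeasure ((Measure.volumeIoiPow (Module.finrank ℝ E - 1)).restrict I) := by
    refine ⟨?_⟩
    rw [Measure.restrict_apply_univ, hI, Measure.volumeIoiPow_apply_Iio]
    exact ENNReal.ofReal_lt_top
  have h1 := hm.comp_fst ((Measure.volumeIoiPow (Module.finrank ℝ E - 1)).restrict I)
  have hmp := (volume : Measure E).measurePreserving_homeomorphUnitSphereProd.restrict_preimage
    (s := Set.univ ×ˢ I) (MeasurableSet.univ.prod measurableSet_Iio)
  rw [← Measure.prod_restrict, Measure.restrict_univ] at hmp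
  have h2 := h1.comp_measurePreserving hmp
  have hpre : homeomorphUnitSphereProd E ⁻¹' (Set.univ ×ˢ I) =
      (Subtype.val : ({0}ᶜ : Set E) → E) ⁻¹' Metric.ball 0 1 := by
    ext x
    simp [hI, ← Subtype.coe_lt_coe]
  rw [← eq_comp_homeomorphUnitSphereProd hΩ, hpre,
    ← (MeasurableEmbedding.subtype_coe hs).memLp_map_measure_iff,
    ← Measure.restrict_map measurable_subtype_coe measurableSet_ball,
    map_comap_subtype_coe hs, restrict_compl_singleton] at h2
  exact h2

theorem lintegral_enorm_mul_le_eLpNorm_mul {X : Type*} [MeasurableSpace X] (μ : Measure X)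
    {s : ℝ≥0∞} (hs : 1 < s) {w : X → 𝕜} (hw : AEStronglyMeasurable w μ) {γ : X → ℝ≥0∞}
    (hγ : AEMeasurable γ μ) :
    ∫⁻ y, ‖w y‖ₑ * γ y ∂μ ≤ eLpNorm w s μ *
      (∫⁻ y, γ y ^ (ENNReal.conjExponent s).toReal ∂μ) ^ (1 / (ENNReal.conjExponent s).toReal) := by
  rcases eq_or_ne s ∞ with rfl | hsT
  · have : ENNReal.conjExponent ∞ = 1 := by simp [ENNReal.conjExponent]
    simp only [this, ENNReal.toReal_one, ENNReal.rpow_one, div_one]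
    rw [eLpNorm_exponent_top, ← lintegral_const_mul'' _ hγ]
    refine lintegral_mono_ae ?_
    filter_upwards [ENNReal.ae_le_essSup (μ := μ) fun y => ‖w y‖ₑ] with y hy
    gcongr
    exact hy
  · have : s.HolderConjugate (ENNReal.conjExponent s) := .conjExponent hs.le
    have h1 : 1 < s.toReal := by
      rw [← ENNReal.toReal_one]
      exact (ENNReal.toReal_lt_toReal (by simp) hsT).2 hs
    have h2 := ENNReal.HolderConjugate.toReal (q := ENNReal.conjExponent s) h1
    rw [eLpNorm_eq_lintegral_rpow_enorm_toReal (by positivity) hsT]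
    exact ENNReal.lintegral_mul_le_Lp_mul_Lq μ h2 hw.enorm hγ

theorem conjExponent_ne_top {s : ℝ≥0∞} (hs : 1 < s) : ENNReal.conjExponent s ≠ ∞ := by
  simp [ENNReal.conjExponent, tsub_eq_zero_iff_le, hs]

theorem one_le_toReal_conjExponent {s : ℝ≥0∞} (hs : 1 < s) :
    1 ≤ (ENNReal.conjExponent s).toReal := by
  rw [← ENNReal.toReal_one]
  exact ENNReal.toReal_mono (conjExponent_ne_top hs) (by simp [ENNReal.conjExponent])

theorem toReal_one_div_add_one_div_toReal_conjExponent {s : ℝ≥0∞} (hs : 1 < s) :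
    (1 / s).toReal + 1 / (ENNReal.conjExponent s).toReal = 1 := by
  have : s.HolderConjugate (ENNReal.conjExponent s) := .conjExponent hs.le
  have h := congrArg ENNReal.toReal (ENNReal.HolderConjugate.inv_add_inv_eq_one s
    (ENNReal.conjExponent s))
  have h0 : s⁻¹ ≠ ∞ := ENNReal.inv_ne_top.2 (by positivity)
  have h1 : (ENNReal.conjExponent s)⁻¹ ≠ ∞ :=
    ENNReal.inv_ne_top.2 (by simp [ENNReal.conjExponent])
  rw [ENNReal.toReal_add h0 h1, ENNReal.toReal_one] at h
  simpa [ENNReal.toReal_inv] using h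

/-- The scaling of the `L^s` norm of a function homogeneous of degree zero. -/
theorem eLpNorm_ball_of_homogeneous {Ω : E → 𝕜} {s : ℝ≥0∞}
    (hΩ : ∀ t : ℝ, 0 < t → ∀ x : E, Ω (t • x) = Ω x)
    (hm : AEStronglyMeasurable Ω (volume : Measure E)) (x : E) {R : ℝ} (hR : 0 < R) :
    eLpNorm (fun y => Ω (x - y)) s (volume.restrict (Metric.ball x R)) =
      (volume (Metric.ball x R) / volume (Metric.ball (0 : E) 1)) ^ (1 / s).toReal *
        eLpNorm Ω s (volume.restrict (Metric.ball (0 : E) 1)) := by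
  have hmp := (Measure.measurePreserving_sub_left (volume : Measure E) x).restrict_preimage
    (s := Metric.ball 0 R) measurableSet_ball
  have hpre : (fun y => x - y) ⁻¹' Metric.ball (0 : E) R = Metric.ball x R := by
    ext y
    simp [dist_eq_norm, norm_sub_rev]
  rw [hpre] at hmp
  have h1 := eLpNorm_comp_measurePreserving (p := s) hm.restrict hmp
  -- c = R^{-d}, with d the dimension, is the Jacobian factor of the dilation by R; Ω itself is
  -- unchanged by that dilation.
  set c : ℝ≥0∞ := ENNReal.ofReal |(R ^ Module.finrank ℝ E)⁻¹| with hc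
  have hc0 : c ≠ 0 := by
    rw [hc, Ne, ENNReal.ofReal_eq_zero, not_le]
    positivity
  have hmp2 : MeasurePreserving (fun y : E => R • y) volume (c • volume) :=
    ⟨measurable_const_smul R, Measure.map_addHaar_smul _ hR.ne'⟩
  have hmp3 := hmp2.restrict_preimage (s := Metric.ball 0 R) measurableSet_ball
  have hpre2 : (fun y => R • y) ⁻¹' Metric.ball (0 : E) R = Metric.ball 0 1 := by
    ext y
    simp [norm_smul, abs_of_pos hR, mul_lt_iff_lt_one_right hR]
  rw [hpre2, Measure.restrict_smul] at hmp3
  have h2 := eLpNorm_comp_measurePreserving (p := s) (hm.restrict.smul_measure c) hmp3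
  have h3 : Ω ∘ (fun y => R • y) = Ω := funext fun y => hΩ R hR y
  rw [h3, eLpNorm_smul_measure_of_ne_zero hc0, smul_eq_mul] at h2
  have hcinv : volume (Metric.ball x R) / volume (Metric.ball (0 : E) 1) = c⁻¹ := by
    rw [Measure.addHaar_ball_of_pos _ _ hR, ENNReal.mul_div_cancel_right
      (volume_ball_ne_zero _ one_pos) (volume_ball_ne_top _ _), hc,
      abs_of_pos (by positivity), ENNReal.ofReal_inv_of_pos (by positivity), inv_inv]
  have hcT : c ≠ ∞ := ENNReal.ofReal_ne_top
  change eLpNorm (Ω ∘ fun y => x - y) s _ = _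
  rw [h1, h2, hcinv, ← mul_assoc, ← ENNReal.mul_rpow_of_nonneg _ _ ENNReal.toReal_nonneg,
    ENNReal.inv_mul_cancel hc0 hcT, ENNReal.one_rpow, one_mul]

/-- The averages of `|Ω(x - ·)| γ` are controlled by the `s'`-means of `γ`. -/
theorem exists_setLIntegral_enorm_mul_le {Ω : E → 𝕜} {s : ℝ≥0∞} (hs : 1 < s)
    (hΩ : ∀ t : ℝ, 0 < t → ∀ x : E, Ω (t • x) = Ω x)
    (hm : MemLp (fun x : Metric.sphere (0 : E) 1 => Ω x) s (volume : Measure E).toSphere) :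
    ∃ A : ℝ≥0∞, A ≠ ∞ ∧ ∀ (γ : E → ℝ≥0∞), AEMeasurable γ → ∀ (x : E) (R : ℝ), 0 < R →
      ∫⁻ y in Metric.ball x R, ‖Ω (x - y)‖ₑ * γ y ≤ A * (volume (Metric.ball x R) *
        ballMean R (fun y => γ y ^ (ENNReal.conjExponent s).toReal) x ^
          (1 / (ENNReal.conjExponent s).toReal)) := by
  have hm' := aestronglyMeasurable_of_homogeneous hΩ hm.1
  have hball := memLp_ball_of_homogeneous hΩ hm
  set t := (ENNReal.conjExponent s).toReal with ht
  have ht1 : 1 ≤ t := one_le_toReal_conjExponent hs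
  have hst := toReal_one_div_add_one_div_toReal_conjExponent hs
  rw [← ht] at hst
  set a := (1 / s).toReal with ha
  have ha0 : 0 ≤ a := ENNReal.toReal_nonneg
  have ht0 : 0 ≤ 1 / t := by positivity
  refine ⟨(volume (Metric.ball (0 : E) 1))⁻¹ ^ a *
    eLpNorm Ω s (volume.restrict (Metric.ball (0 : E) 1)), ?_, fun γ hγ x R hR => ?_⟩
  · refine ENNReal.mul_ne_top (ENNReal.rpow_ne_top_of_nonneg ha0 ?_) hball.2.ne
    exact ENNReal.inv_ne_top.2 (volume_ball_ne_zero _ one_pos)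
  have hV0 := volume_ball_ne_zero x hR
  have hVT := volume_ball_ne_top x R
  set V := volume (Metric.ball x R) with hV
  have hmean : ∫⁻ y in Metric.ball x R, γ y ^ t = V * ballMean R (fun y => γ y ^ t) x := by
    rw [ballMean, ← mul_assoc, ENNReal.mul_inv_cancel hV0 hVT, one_mul]
  refine (lintegral_enorm_mul_le_eLpNorm_mul _ hs (hm'.comp_quasiMeasurePreserving
    (quasiMeasurePreserving_sub_left volume x)).restrict hγ.restrict).trans (le_of_eq ?_)
  rw [Function.comp_def, eLpNorm_ball_of_homogeneous hΩ hm' x hR, ← ht, ← ha, hmean,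
    ENNReal.mul_rpow_of_nonneg _ _ ht0, div_eq_mul_inv V, ENNReal.mul_rpow_of_nonneg _ _ ha0]
  -- Conjugacy, a + 1/t = 1, merges the volume power from the norm of Ω with the one from the
  -- t-mean.
  have : V = V ^ a * V ^ (1 / t) := by
    rw [← ENNReal.rpow_add_of_nonneg _ _ ha0 ht0, hst, ENNReal.rpow_one]
  conv_rhs => rw [this]
  ring

/-- **Tonelli's theorem** for a product of functions of one variable each. -/
theorem lintegral_fin_prod_eq_prod {m : ℕ} {X : Type*} [MeasurableSpace X] (μ : Measure X)
    [SigmaFinite μ] (f : Fin m → X → ℝ≥0∞) (hf : ∀ i, AEMeasurable (f i) μ) :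
    ∫⁻ x : Fin m → X, ∏ i, f i (x i) ∂(Measure.pi fun _ => μ) = ∏ i, ∫⁻ x, f i x ∂μ := by
  induction m with
  | zero => simp
  | succ n ih =>
    have hmp := (measurePreserving_piFinSuccAbove (fun _ : Fin (n + 1) => μ) 0).symm
    rw [← hmp.lintegral_comp_emb (MeasurableEquiv.measurableEmbedding _)]
    simp_rw [MeasurableEquiv.piFinSuccAbove_symm_apply, Fin.insertNthEquiv,
      Fin.prod_univ_succ, Fin.insertNth_zero]
    simp only [Equiv.coe_fn_mk, Fin.cons_zero, Fin.cons_succ, cast_eq]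
    rw [← ih _ fun i => hf i.succ]
    exact lintegral_prod_mul (g := fun y : Fin n → X => ∏ i, f i.succ (y i)) (hf 0)
      (Finset.aemeasurable_fun_prod _ fun i _ => (hf i.succ).comp_quasiMeasurePreserving
        (Measure.quasiMeasurePreserving_eval _ i))

end Kernel

/-! ### The pointwise Hedberg bound. -/

section Pointwise

variable {𝕜 : Type*} [RCLike 𝕜] {n m : ℕ}

theorem IsRoughKernel.memLp_toSphere {s : ℝ≥0∞} {Ω : EuclideanSpace ℝ (Fin n) → 𝕜}
    [Nontrivial (EuclideanSpace ℝ (Fin n))] (hΩ : IsRoughKernel s Ω) :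
    MemLp (fun x : Metric.sphere (0 : EuclideanSpace ℝ (Fin n)) 1 => Ω x) s
      (volume : Measure (EuclideanSpace ℝ (Fin n))).toSphere := by
  have h0 : (volume : Measure (EuclideanSpace ℝ (Fin n))).toSphere Set.univ ≠ 0 := by
    rw [Ne, Measure.measure_univ_eq_zero]
    exact Measure.toSphere_ne_zero _
  have hT : (volume : Measure (EuclideanSpace ℝ (Fin n))).toSphere Set.univ ≠ ∞ :=
    measure_ne_top _ _
  have h := hΩ.memLp.smul_measure hT
  rwa [sphereMeasure, smul_smul, ENNReal.mul_inv_cancel h0 hT, one_smul] at h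

theorem enorm_finset_prod {ι : Type*} (s : Finset ι) (f : ι → 𝕜) :
    ‖∏ i ∈ s, f i‖ₑ = ∏ i ∈ s, ‖f i‖ₑ := by
  simp [enorm, nnnorm_prod]

theorem ennreal_rpow_sum {ι : Type*} {s : Finset ι} {x : ℝ≥0∞} (hx : x ≠ 0) (hx' : x ≠ ∞)
    (f : ι → ℝ) : x ^ (∑ i ∈ s, f i) = ∏ i ∈ s, x ^ f i := by
  classical
  induction s using Finset.induction_on with
  | empty => simp
  | insert a s ha ih =>
    rw [Finset.sum_insert ha, Finset.prod_insert ha, ENNReal.rpow_add _ _ hx hx', ih]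

/-- The dyadic decomposition of the integrand. -/
theorem enorm_fracIntegrand_le_tsum (Ω : Fin m → EuclideanSpace ℝ (Fin n) → 𝕜) {α : ℝ}
    (hα : α < (m : ℝ) * (n : ℝ)) (g : Fin m → EuclideanSpace ℝ (Fin n) → 𝕜)
    (x : EuclideanSpace ℝ (Fin n)) (y : Fin m → EuclideanSpace ℝ (Fin n)) :
    ‖fracIntegrand Ω α g x y‖ₑ ≤ ∑' k : ℤ, (2 : ℝ≥0∞) ^ (-(((k : ℝ) - 1) * (m * n - α))) *
      ∏ i, (Metric.ball x ((2 : ℝ) ^ k)).indicator (fun z => ‖Ω i (x - z)‖ₑ * ‖g i z‖ₑ) (y i) := by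
  set ϱ := Real.sqrt (∑ j, ‖x - y j‖ ^ 2) with hϱ
  set b := (m : ℝ) * n - α with hb
  have hb0 : 0 < b := by linarith
  -- On the diagonal ϱ = 0 the denominator is 0, and division by zero makes the integrand 0.
  rcases (Real.sqrt_nonneg _).eq_or_lt' with h0 | h0
  · have : fracIntegrand Ω α g x y = 0 := by
      rw [fracIntegrand, h0, Real.zero_rpow hb0.ne']
      simp
    rw [this]
    simp
  · rw [← hϱ] at h0
    obtain ⟨j, hj, hj'⟩ := exists_mem_Ico_zpow h0 (one_lt_two : (1 : ℝ) < 2)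
    -- With 2^j ≤ ϱ < 2^{j+1}, the open balls of radius 2^{j+1} contain all y_i while the kernel is
    -- at most 2^{-jb}; hence the index j + 1 and the shift k - 1 in the exponent.
    refine le_trans ?_ (ENNReal.le_tsum (j + 1))
    have hmem : ∀ i, y i ∈ Metric.ball x ((2 : ℝ) ^ (j + 1)) := fun i => by
      rw [Metric.mem_ball, dist_comm, dist_eq_norm]
      refine lt_of_le_of_lt ?_ hj'
      refine Real.le_sqrt_of_sq_le ?_
      exact Finset.single_le_sum (f := fun j => ‖x - y j‖ ^ 2) (fun _ _ => by positivity)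
        (Finset.mem_univ i)
    simp_rw [Set.indicator_of_mem (hmem _)]
    have hD : ‖((ϱ ^ b : ℝ) : 𝕜)⁻¹‖ₑ ≤ (2 : ℝ≥0∞) ^ (-(((j + 1 : ℤ) : ℝ) - 1) * b) := by
      rw [← ofReal_norm, norm_inv, RCLike.norm_ofReal, abs_of_nonneg (by positivity)]
      have h2 : (2 : ℝ≥0∞) = ENNReal.ofReal 2 := by simp
      rw [h2, ENNReal.ofReal_rpow_of_pos (by norm_num)]
      refine ENNReal.ofReal_le_ofReal ?_
      have e : -(((j + 1 : ℤ) : ℝ) - 1) * b = -(j * b) := by push_cast; ring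
      rw [e, Real.rpow_neg (by norm_num), Real.rpow_mul (by norm_num), Real.rpow_intCast]
      gcongr
    rw [neg_mul] at hD
    rw [fracIntegrand, ← hϱ, ← hb, Finset.prod_mul_distrib, div_eq_mul_inv, enorm_mul, enorm_mul,
      enorm_finset_prod, enorm_finset_prod]
    calc _ = ‖((ϱ ^ b : ℝ) : 𝕜)⁻¹‖ₑ * ((∏ i, ‖Ω i (x - y i)‖ₑ) * ∏ i, ‖g i (y i)‖ₑ) := by ring
      _ ≤ _ := by gcongr

theorem volume_ball_two_zpow {E : Type*} [NormedAddCommGroup E] [NormedSpace ℝ E]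
    [FiniteDimensional ℝ E] [MeasureSpace E] [BorelSpace E] [(volume : Measure E).IsAddHaarMeasure]
    (x : E) (k : ℤ) :
    volume (Metric.ball x ((2 : ℝ) ^ k)) =
      (2 : ℝ≥0∞) ^ (k * (Module.finrank ℝ E : ℝ)) * volume (Metric.ball (0 : E) 1) := by
  rw [Measure.addHaar_ball_of_pos _ _ (by positivity : (0 : ℝ) < 2 ^ k)]
  congr 1
  have h2 : (2 : ℝ≥0∞) = ENNReal.ofReal 2 := by simp
  rw [h2, ENNReal.ofReal_rpow_of_pos (by norm_num), Real.rpow_mul (by norm_num),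
    Real.rpow_intCast, Real.rpow_natCast]

/-- Jensen with exponent u/t applied to γ^t, followed by a u-th root. This is the decaying one of
the two bounds for t-means. -/
theorem ballMean_rpow_one_div_le_of_morrey {E : Type*} [NormedAddCommGroup E] [NormedSpace ℝ E]
    [FiniteDimensional ℝ E] [MeasureSpace E] [BorelSpace E] [(volume : Measure E).IsAddHaarMeasure]
    [Nontrivial E] {t u κ : ℝ} (ht : 1 ≤ t) (htu : t ≤ u) {γ : E → ℝ≥0∞} (hγ : AEMeasurable γ)
    {G : ℝ≥0∞}
    (hG : ∀ (x : E) (R : ℝ), 0 < R →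
      ∫⁻ y in Metric.ball x R, γ y ^ u ≤ G ^ u * volume (Metric.ball x R) ^ κ)
    (x : E) {R : ℝ} (hR : 0 < R) :
    ballMean R (fun y => γ y ^ t) x ^ (1 / t) ≤ G * volume (Metric.ball x R) ^ ((κ - 1) / u) := by
  have ht0 : 0 < t := by linarith
  have hu0 : 0 < u := by linarith
  have h := ballMean_rpow_le_of_morrey (u := u / t) (κ := κ) (h := fun y => γ y ^ t)
    ((one_le_div ht0).2 htu) (hγ.pow_const t) (N := G ^ u) (fun x R hR => by
      simp_rw [← ENNReal.rpow_mul, mul_div_cancel₀ u ht0.ne']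
      exact hG x R hR) hR x
  have h1 := ENNReal.rpow_le_rpow h (z := 1 / u) (by positivity)
  rw [ENNReal.mul_rpow_of_nonneg _ _ (by positivity), ← ENNReal.rpow_mul, ← ENNReal.rpow_mul,
    ← ENNReal.rpow_mul, mul_one_div_cancel hu0.ne', ENNReal.rpow_one] at h1
  convert h1 using 2 <;> field_simp

theorem lintegral_enorm_fracIntegrand_le_tsum {Ω : Fin m → EuclideanSpace ℝ (Fin n) → 𝕜} {α : ℝ}
    (hα : α < (m : ℝ) * (n : ℝ)) (hΩ : ∀ i, AEStronglyMeasurable (Ω i))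
    {g : Fin m → EuclideanSpace ℝ (Fin n) → 𝕜} (hg : ∀ i, AEStronglyMeasurable (g i))
    (x : EuclideanSpace ℝ (Fin n)) :
    ∫⁻ y, ‖fracIntegrand Ω α g x y‖ₑ ≤
      ∑' k : ℤ, (2 : ℝ≥0∞) ^ (-(((k : ℝ) - 1) * (m * n - α))) *
        ∏ i, ∫⁻ z in Metric.ball x ((2 : ℝ) ^ k), ‖Ω i (x - z)‖ₑ * ‖g i z‖ₑ := by
  have hm : ∀ (k : ℤ) (i : Fin m), AEMeasurable ((Metric.ball x ((2 : ℝ) ^ k)).indicator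
      (fun z => ‖Ω i (x - z)‖ₑ * ‖g i z‖ₑ)) := fun k i =>
    ((((hΩ i).comp_quasiMeasurePreserving
      (quasiMeasurePreserving_sub_left volume x)).enorm.mul (hg i).enorm)).indicator
      measurableSet_ball
  refine (lintegral_mono fun y => enorm_fracIntegrand_le_tsum Ω hα g x y).trans (le_of_eq ?_)
  rw [lintegral_tsum]
  · refine tsum_congr fun k => ?_
    rw [lintegral_const_mul' _ _ (ENNReal.rpow_ne_top_of_ne_zero (by norm_num) (by norm_num)),
      volume_pi, lintegral_fin_prod_eq_prod volume _ (hm k)]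
    simp_rw [lintegral_indicator measurableSet_ball]
  · refine fun k => AEMeasurable.const_mul ?_ _
    exact Finset.aemeasurable_fun_prod _ fun i _ => (hm k i).comp_quasiMeasurePreserving
      (Measure.quasiMeasurePreserving_eval _ i)

/-- The pointwise bound of the multilinear fractional integral by maximal functions. -/
theorem exists_lintegral_enorm_fracIntegrand_le [Nontrivial (EuclideanSpace ℝ (Fin n))]
    {s : ℝ≥0∞} (hs : 1 < s)
    {Ω : Fin m → EuclideanSpace ℝ (Fin n) → 𝕜} (hΩ : ∀ i, IsRoughKernel s (Ω i))
    {α : ℝ} (hα₀ : 0 < α) (hα : α < (m : ℝ) * (n : ℝ)) {t : ℝ}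
    (ht : t = (ENNReal.conjExponent s).toReal) {P : Fin m → ℝ} (hP : ∀ i, t ≤ P i)
    {κ : ℝ} (hκ₁ : κ < 1) {σ : ℝ} (hσ : 0 < σ)
    (hσS : σ * (∑ i, 1 / P i) = ∑ i, 1 / P i - α / ((n : ℝ) * (1 - κ)))
    (hS : 0 < ∑ i, 1 / P i) (hn : 0 < (n : ℝ)) :
    ∃ C : ℝ≥0∞, C ≠ ∞ ∧ ∀ (g : Fin m → EuclideanSpace ℝ (Fin n) → 𝕜),
      (∀ i, AEStronglyMeasurable (g i)) → ∀ (G : Fin m → ℝ≥0∞), (∀ i, G i ≠ ∞) →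
      (∀ i (x : EuclideanSpace ℝ (Fin n)) (R : ℝ), 0 < R →
        ∫⁻ y in Metric.ball x R, ‖g i y‖ₑ ^ P i ≤ G i ^ P i * volume (Metric.ball x R) ^ κ) →
      ∀ x, ∫⁻ y, ‖fracIntegrand Ω α g x y‖ₑ ≤
        C * ((∏ i, dyadicMaximal (fun y => ‖g i y‖ₑ ^ t) x ^ (1 / t)) ^ σ *
          (∏ i, G i) ^ (1 - σ)) := by
  have ht1 : 1 ≤ t := ht ▸ one_le_toReal_conjExponent hs
  choose A hAT hA using fun i => exists_setLIntegral_enorm_mul_le hs (hΩ i).homogeneous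
    (hΩ i).memLp_toSphere
  rw [← ht] at hA
  have hΩm : ∀ i, AEStronglyMeasurable (Ω i) := fun i =>
    aestronglyMeasurable_of_homogeneous (hΩ i).homogeneous (hΩ i).memLp_toSphere.1
  set S := ∑ i, 1 / P i with hSdef
  set δ := (n : ℝ) * (1 - κ) with hδ
  have hδ0 : 0 < δ := mul_pos hn (by linarith)
  -- β = δS - α is the decay rate left when the Morrey bounds beat the growth 2^{kα}. The weights in
  -- the sum of minima thus become σ and 1 - σ.
  set β := σ * S * δ with hβ
  have hβ0 : 0 < β := by positivity
  have hαβ : α + β = δ * S := by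
    rw [hβ, hσS]; field_simp; ring
  have hσ' : β / (α + β) = σ := by
    rw [hαβ, hβ]; field_simp
  have hσ'' : α / (α + β) = 1 - σ := by
    rw [← hσ']; field_simp; ring
  obtain ⟨C, hCT, hC⟩ := exists_tsum_min_geometric_le hα₀ hβ0
  rw [hσ', hσ''] at hC
  set V := volume (Metric.ball (0 : EuclideanSpace ℝ (Fin n)) 1) with hV
  have hV0 : V ≠ 0 := volume_ball_ne_zero _ one_pos
  have hVT : V ≠ ∞ := volume_ball_ne_top _ _
  set b := (m : ℝ) * n - α with hb
  set W := V ^ ((κ - 1) * S) with hW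
  have hWT : W ≠ ∞ := ENNReal.rpow_ne_top_of_ne_zero hV0 hVT
  have h1σ : 0 ≤ 1 - σ := by rw [← hσ'']; positivity
  refine ⟨2 ^ b * (∏ i, A i) * V ^ m * (C * W ^ (1 - σ)), ?_, fun g hg G hGT hG x => ?_⟩
  · refine ENNReal.mul_ne_top (ENNReal.mul_ne_top (ENNReal.mul_ne_top ?_ ?_) ?_)
      (ENNReal.mul_ne_top hCT ?_)
    · exact ENNReal.rpow_ne_top_of_ne_zero (by norm_num) (by norm_num)
    · exact ENNReal.prod_ne_top fun i _ => hAT i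
    · exact ENNReal.pow_ne_top hVT
    · exact ENNReal.rpow_ne_top_of_nonneg h1σ hWT
  have h2 : ∀ x y : ℝ, (2 : ℝ≥0∞) ^ x * 2 ^ y = 2 ^ (x + y) := fun x y =>
    (ENNReal.rpow_add _ _ (by norm_num) (by norm_num)).symm
  have hvol : ∀ k : ℤ, volume (Metric.ball x ((2 : ℝ) ^ k)) = (2 : ℝ≥0∞) ^ ((k : ℝ) * n) * V :=
    fun k => by rw [volume_ball_two_zpow, finrank_euclideanSpace_fin]
  set mean : Fin m → ℤ → ℝ≥0∞ := fun i k =>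
    ballMean ((2 : ℝ) ^ k) (fun y => ‖g i y‖ₑ ^ t) x ^ (1 / t) with hmean
  have hmean1 : ∀ i k, mean i k ≤ dyadicMaximal (fun y => ‖g i y‖ₑ ^ t) x ^ (1 / t) :=
    fun i k => ENNReal.rpow_le_rpow (le_iSup (fun k : ℤ => ballMean ((2 : ℝ) ^ k)
      (fun y => ‖g i y‖ₑ ^ t) x) k) (by positivity)
  have hmean2 : ∀ i k, mean i k ≤ G i * ((2 : ℝ≥0∞) ^ ((k : ℝ) * n) * V) ^ ((κ - 1) * (1 / P i)) :=
    fun i k => by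
      have := ballMean_rpow_one_div_le_of_morrey ht1 (hP i) (hg i).enorm (hG i) x
        (by positivity : (0 : ℝ) < 2 ^ k)
      rwa [hvol, ← mul_one_div (κ - 1)] at this
  -- The m ball volumes give 2^{kmn}, which cancels against the kernel's 2^{-k(mn-α)} down to
  -- 2^{kα}.
  have hterm : ∀ k : ℤ, (2 : ℝ≥0∞) ^ (-(((k : ℝ) - 1) * b)) *
        ∏ i, ∫⁻ z in Metric.ball x ((2 : ℝ) ^ k), ‖Ω i (x - z)‖ₑ * ‖g i z‖ₑ ≤
      2 ^ b * (∏ i, A i) * V ^ m * (2 ^ ((k : ℝ) * α) * ∏ i, mean i k) := fun k => by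
    calc _ ≤ (2 : ℝ≥0∞) ^ (-(((k : ℝ) - 1) * b)) *
          ∏ i, (A i * (((2 : ℝ≥0∞) ^ ((k : ℝ) * n) * V) * mean i k)) := by
          refine mul_le_mul' le_rfl (Finset.prod_le_prod' fun i _ => ?_)
          have := hA i _ (hg i).enorm x ((2 : ℝ) ^ k) (by positivity)
          rwa [hvol] at this
      _ = ((2 : ℝ≥0∞) ^ (-(((k : ℝ) - 1) * b)) * 2 ^ ((k : ℝ) * n * m)) *
          (∏ i, A i) * V ^ m * ∏ i, mean i k := by
          rw [Finset.prod_mul_distrib, Finset.prod_mul_distrib, Finset.prod_const,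
            Finset.card_univ, Fintype.card_fin, mul_pow, ENNReal.rpow_mul _ _ (m : ℝ),
            ENNReal.rpow_natCast]
          ring
      _ = (2 ^ b * 2 ^ ((k : ℝ) * α)) * (∏ i, A i) * V ^ m * ∏ i, mean i k := by
          rw [h2, h2]
          congr 4
          rw [hb]; ring
      _ = _ := by ring
  have hmin : ∀ k : ℤ, 2 ^ ((k : ℝ) * α) * ∏ i, mean i k ≤
      min ((2 : ℝ≥0∞) ^ ((k : ℝ) * α) *
        ∏ i, dyadicMaximal (fun y => ‖g i y‖ₑ ^ t) x ^ (1 / t))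
        (2 ^ (-((k : ℝ) * β)) * (W * ∏ i, G i)) := fun k => by
    refine le_min (mul_le_mul' le_rfl (Finset.prod_le_prod' fun i _ => hmean1 i k)) ?_
    calc _ ≤ 2 ^ ((k : ℝ) * α) *
          ∏ i, (G i * ((2 : ℝ≥0∞) ^ ((k : ℝ) * n) * V) ^ ((κ - 1) * (1 / P i))) :=
          mul_le_mul' le_rfl (Finset.prod_le_prod' fun i _ => hmean2 i k)
      _ = 2 ^ ((k : ℝ) * α) * ((∏ i, G i) *
            ((2 : ℝ≥0∞) ^ ((k : ℝ) * n) * V) ^ ((κ - 1) * S)) := by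
          have hX0 : (2 : ℝ≥0∞) ^ ((k : ℝ) * n) * V ≠ 0 := by
            rw [← hvol]; exact volume_ball_ne_zero _ (by positivity)
          have hXT : (2 : ℝ≥0∞) ^ ((k : ℝ) * n) * V ≠ ∞ := by
            rw [← hvol]; exact volume_ball_ne_top _ _
          rw [Finset.prod_mul_distrib, hSdef, Finset.mul_sum,
            ennreal_rpow_sum hX0 hXT]
      _ = (2 ^ ((k : ℝ) * α) * 2 ^ ((k : ℝ) * n * ((κ - 1) * S))) * (W * ∏ i, G i) := by
          rw [ENNReal.mul_rpow_of_ne_top (ENNReal.rpow_ne_top_of_ne_zero (by norm_num)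
            (by norm_num)) hVT, ← ENNReal.rpow_mul]
          ring
      _ = _ := by
          rw [h2]
          congr 2
          have : β = δ * S - α := by linarith
          rw [this, hδ]; ring
  calc _ ≤ ∑' k : ℤ, (2 : ℝ≥0∞) ^ (-(((k : ℝ) - 1) * b)) *
        ∏ i, ∫⁻ z in Metric.ball x ((2 : ℝ) ^ k), ‖Ω i (x - z)‖ₑ * ‖g i z‖ₑ :=
        lintegral_enorm_fracIntegrand_le_tsum hα hΩm hg x
    _ ≤ ∑' k : ℤ, 2 ^ b * (∏ i, A i) * V ^ m * min ((2 : ℝ≥0∞) ^ ((k : ℝ) * α) *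
        ∏ i, dyadicMaximal (fun y => ‖g i y‖ₑ ^ t) x ^ (1 / t))
        (2 ^ (-((k : ℝ) * β)) * (W * ∏ i, G i)) :=
        ENNReal.tsum_le_tsum fun k => (hterm k).trans (mul_le_mul' le_rfl (hmin k))
    _ ≤ 2 ^ b * (∏ i, A i) * V ^ m * (C *
        ((∏ i, dyadicMaximal (fun y => ‖g i y‖ₑ ^ t) x ^ (1 / t)) ^ σ *
          (W * ∏ i, G i) ^ (1 - σ))) := by
        rw [ENNReal.tsum_mul_left]
        exact mul_le_mul' le_rfl (hC _ _ (ENNReal.mul_ne_top hWT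
          (ENNReal.prod_ne_top fun i _ => hGT i)))
    _ = _ := by
        rw [ENNReal.mul_rpow_of_nonneg _ _ h1σ]
        ring

end Pointwise

/-! ### Hölder's inequality for products, strong and weak. -/

section Products

variable {X : Type*} [MeasurableSpace X] {μ : Measure X} {m : ℕ} {a : X → ℝ≥0∞}
  {M : Fin m → X → ℝ≥0∞} {p r σ : ℝ} {P : Fin m → ℝ} {F V : ℝ≥0∞} {G C : Fin m → ℝ≥0∞}

/-- Hölder's inequality for products of functions with Morrey type bounds. -/
theorem lintegral_mul_prod_rpow_rpow_le (ha : AEMeasurable a μ) (hM : ∀ i, AEMeasurable (M i) μ)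
    (hp : 0 < p) (hP : ∀ i, 0 < P i) (hr : 0 < r) (hσ : 0 < σ)
    (hsum : r / p + ∑ i, r * σ / P i = 1) (hV0 : V ≠ 0) (hVT : V ≠ ∞)
    (hF : ∫⁻ x, a x ^ p ∂μ ≤ F ^ p * V)
    (hG : ∀ i, ∫⁻ x, M i x ^ P i ∂μ ≤ C i * (G i ^ P i * V)) :
    ∫⁻ x, (a x * (∏ i, M i x) ^ σ) ^ r ∂μ ≤
      (∏ i, C i ^ (r * σ / P i)) * (F * (∏ i, G i) ^ σ) ^ r * V := by
  have hw : ∀ i, 0 ≤ r * σ / P i := fun i => by have := hP i; positivity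
  have hpr : p * (r / p) = r := by field_simp
  have hPr : ∀ i, P i * (r * σ / P i) = σ * r := fun i => by have := hP i; field_simp
  calc ∫⁻ x, (a x * (∏ i, M i x) ^ σ) ^ r ∂μ
      = ∫⁻ x, (a x ^ p) ^ (r / p) * ∏ i, (M i x ^ P i) ^ (r * σ / P i) ∂μ := by
        refine lintegral_congr fun x => ?_
        simp_rw [← ENNReal.rpow_mul, hpr, hPr]
        rw [ENNReal.mul_rpow_of_nonneg _ _ hr.le, ← ENNReal.rpow_mul,
          ENNReal.prod_rpow_of_nonneg (by positivity)]
    _ ≤ (∫⁻ x, a x ^ p ∂μ) ^ (r / p) * ∏ i, (∫⁻ x, M i x ^ P i ∂μ) ^ (r * σ / P i) :=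
        ENNReal.lintegral_mul_prod_norm_pow_le _ (ha.pow_const _)
          (fun i _ => (hM i).pow_const _) _ hsum (by positivity) fun i _ => hw i
    _ ≤ (F ^ p * V) ^ (r / p) * ∏ i, (C i * (G i ^ P i * V)) ^ (r * σ / P i) := by
        refine mul_le_mul' (ENNReal.rpow_le_rpow hF (by positivity))
          (Finset.prod_le_prod' fun i _ => ENNReal.rpow_le_rpow (hG i) (hw i))
    _ = (∏ i, C i ^ (r * σ / P i)) * (F * (∏ i, G i) ^ σ) ^ r *
          (V ^ (r / p) * ∏ i, V ^ (r * σ / P i)) := by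
        simp_rw [fun i => ENNReal.mul_rpow_of_nonneg (C i) (G i ^ P i * V) (hw i),
          fun i => ENNReal.mul_rpow_of_nonneg (G i ^ P i) V (hw i), ← ENNReal.rpow_mul, hPr]
        rw [ENNReal.mul_rpow_of_nonneg _ _ (by positivity : 0 ≤ r / p), ← ENNReal.rpow_mul, hpr,
          ENNReal.mul_rpow_of_nonneg _ _ hr.le, ← ENNReal.rpow_mul,
          Finset.prod_mul_distrib, Finset.prod_mul_distrib,
          ENNReal.prod_rpow_of_nonneg (by positivity)]
        ring
    _ = _ := by
        rw [← ennreal_rpow_sum hV0 hVT, ← ENNReal.rpow_add _ _ hV0 hVT, hsum, ENNReal.rpow_one]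

/-- Hölder's inequality in weak spaces, for products of functions with Morrey type bounds. -/
theorem rpow_mul_measure_lt_mul_prod_rpow_le
    (hp : 0 < p) (hP : ∀ i, 0 < P i) (hσ : 0 < σ)
    (hsum : r / p + ∑ i, r * σ / P i = 1)
    (hF0 : F ≠ 0) (hFT : F ≠ ∞) (hG0 : ∀ i, G i ≠ 0) (hGT : ∀ i, G i ≠ ∞)
    (hF : ∀ l : ℝ≥0∞, l ^ p * μ {x | l < a x} ≤ F ^ p * V)
    (hG : ∀ i, ∀ l : ℝ≥0∞, l ^ P i * μ {x | l < M i x} ≤ C i * (G i ^ P i * V))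
    {ν : ℝ≥0∞} (hν0 : ν ≠ 0) (hνT : ν ≠ ∞) :
    ν ^ r * μ {x | ν * (F * (∏ i, G i) ^ σ) < a x * (∏ i, M i x) ^ σ} ≤ (1 + ∑ i, C i) * V := by
  have cancel : ∀ {Q : ℝ} {N D : ℝ≥0∞} {s : Set X}, 0 < Q → N ≠ 0 → N ≠ ∞ →
      (N * ν ^ (r / Q)) ^ Q * μ s ≤ D * (N ^ Q * V) → ν ^ r * μ s ≤ D * V := by
    intro Q N D s hQ hN0 hNT h
    rw [ENNReal.mul_rpow_of_nonneg _ _ hQ.le, ← ENNReal.rpow_mul, div_mul_cancel₀ _ hQ.ne',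
      mul_assoc, mul_left_comm D] at h
    exact (ENNReal.mul_le_mul_iff_right (by simp [hN0, hNT])
      (ENNReal.rpow_ne_top_of_nonneg hQ.le hNT)).1 h
  -- The height ν is distributed as ν^{r/p} to a and ν^{r/P_i} to M_i. By `hsum` these recombine to
  -- ν, so if no factor exceeds its own threshold then neither does the product. Each weak bound at
  -- such a threshold yields the same factor ν^r.
  have hsub : {x | ν * (F * (∏ i, G i) ^ σ) < a x * (∏ i, M i x) ^ σ} ⊆
      {x | F * ν ^ (r / p) < a x} ∪ ⋃ i, {x | G i * ν ^ (r / P i) < M i x} := by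
    intro x hx
    by_contra hcon
    simp only [Set.mem_union, Set.mem_iUnion, Set.mem_ofPred_eq, not_or, not_exists,
      not_lt] at hcon
    have hx' : ν * (F * (∏ i, G i) ^ σ) < a x * (∏ i, M i x) ^ σ := hx
    refine absurd hx' (not_lt.2 ?_)
    calc a x * (∏ i, M i x) ^ σ ≤ F * ν ^ (r / p) * (∏ i, G i * ν ^ (r / P i)) ^ σ := by
          refine mul_le_mul' hcon.1 (ENNReal.rpow_le_rpow ?_ hσ.le)
          exact Finset.prod_le_prod' fun i _ => hcon.2 i
      _ = (ν ^ (r / p) * ν ^ (∑ i, r * σ / P i)) * (F * (∏ i, G i) ^ σ) := by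
          rw [Finset.prod_mul_distrib, ENNReal.mul_rpow_of_nonneg _ _ hσ.le,
            ← ennreal_rpow_sum hν0 hνT, ← ENNReal.rpow_mul, Finset.sum_mul]
          simp_rw [div_mul_eq_mul_div]
          ring
      _ = _ := by rw [← ENNReal.rpow_add _ _ hν0 hνT, hsum, ENNReal.rpow_one]
  calc _ ≤ ν ^ r * (μ {x | F * ν ^ (r / p) < a x} +
        ∑ i, μ {x | G i * ν ^ (r / P i) < M i x}) := by
        refine mul_le_mul' le_rfl ((measure_mono hsub).trans ((measure_union_le _ _).trans ?_))
        gcongr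
        exact measure_iUnion_fintype_le _ _
    _ = ν ^ r * μ {x | F * ν ^ (r / p) < a x} +
        ∑ i, ν ^ r * μ {x | G i * ν ^ (r / P i) < M i x} := by
        rw [mul_add, Finset.mul_sum]
    _ ≤ 1 * V + ∑ i, C i * V := by
        refine add_le_add (cancel hp hF0 hFT ?_) (Finset.sum_le_sum fun i _ => ?_)
        · rw [one_mul]; exact hF _
        · exact cancel (hP i) (hG0 i) (hGT i) (hG i _)
    _ = _ := by rw [← Finset.sum_mul, ← add_mul]

end Products

/-! ### Morrey norms ball by ball, and measurability of the integral operator. -/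

section Morrey

variable {𝕜 : Type*} [RCLike 𝕜] {n m : ℕ}

theorem setLIntegral_enorm_rpow_le_morreyNorm {p κ : ℝ} (hp : 0 < p)
    (f : EuclideanSpace ℝ (Fin n) → 𝕜) [Nontrivial (EuclideanSpace ℝ (Fin n))]
    (x : EuclideanSpace ℝ (Fin n)) (R : ℝ) (hR : 0 < R) :
    ∫⁻ y in Metric.ball x R, ‖f y‖ₑ ^ p ≤ morreyNorm p κ f ^ p * volume (Metric.ball x R) ^ κ := by
  have h : ((volume (Metric.ball x R) ^ κ)⁻¹ * ∫⁻ y in Metric.ball x R, ‖f y‖ₑ ^ p) ^ (1 / p) ≤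
      morreyNorm p κ f := le_iSup_of_le x (le_iSup_of_le R (le_iSup_of_le hR le_rfl))
  have hV0 : volume (Metric.ball x R) ^ κ ≠ 0 := by
    simp [ENNReal.rpow_eq_zero_iff, volume_ball_ne_zero x hR, volume_ball_ne_top x R]
  have hVT : volume (Metric.ball x R) ^ κ ≠ ∞ :=
    ENNReal.rpow_ne_top_of_ne_zero (volume_ball_ne_zero x hR) (volume_ball_ne_top x R)
  rw [one_div, ENNReal.rpow_inv_le_iff hp, mul_comm, ← div_eq_mul_inv,
    ENNReal.div_le_iff hV0 hVT] at h
  exact h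

theorem morreyNorm_le_of_forall {r κ : ℝ} (hr : 0 < r) [Nontrivial (EuclideanSpace ℝ (Fin n))]
    {f : EuclideanSpace ℝ (Fin n) → 𝕜} {D : ℝ≥0∞}
    (h : ∀ (x : EuclideanSpace ℝ (Fin n)) (R : ℝ), 0 < R →
      ∫⁻ y in Metric.ball x R, ‖f y‖ₑ ^ r ≤ D ^ r * volume (Metric.ball x R) ^ κ) :
    morreyNorm r κ f ≤ D := by
  refine iSup_le fun x => iSup_le fun R => iSup_le fun hR => ?_
  have hV0 : volume (Metric.ball x R) ^ κ ≠ 0 := by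
    simp [ENNReal.rpow_eq_zero_iff, volume_ball_ne_zero x hR, volume_ball_ne_top x R]
  have hVT : volume (Metric.ball x R) ^ κ ≠ ∞ :=
    ENNReal.rpow_ne_top_of_ne_zero (volume_ball_ne_zero x hR) (volume_ball_ne_top x R)
  rw [one_div, ENNReal.rpow_inv_le_iff hr, mul_comm, ← div_eq_mul_inv,
    ENNReal.div_le_iff hV0 hVT]
  exact h x R hR

theorem weakMorreyNorm_le_of_forall {r κ : ℝ} (hr : 0 < r)
    [Nontrivial (EuclideanSpace ℝ (Fin n))] {f : EuclideanSpace ℝ (Fin n) → 𝕜} {D : ℝ≥0∞}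
    (h : ∀ (x : EuclideanSpace ℝ (Fin n)) (R : ℝ), 0 < R → ∀ l : ℝ, 0 < l →
      ENNReal.ofReal l ^ r * volume {y | y ∈ Metric.ball x R ∧ ENNReal.ofReal l < ‖f y‖ₑ} ≤
        D ^ r * volume (Metric.ball x R) ^ κ) :
    weakMorreyNorm r κ f ≤ D := by
  refine iSup_le fun x => iSup_le fun R => iSup_le fun hR => iSup_le fun l => iSup_le fun hl => ?_
  have hV0 : volume (Metric.ball x R) ^ (κ / r) ≠ 0 := by
    simp [ENNReal.rpow_eq_zero_iff, volume_ball_ne_zero x hR, volume_ball_ne_top x R]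
  have hVT : volume (Metric.ball x R) ^ (κ / r) ≠ ∞ :=
    ENNReal.rpow_ne_top_of_ne_zero (volume_ball_ne_zero x hR) (volume_ball_ne_top x R)
  rw [mul_comm, ← div_eq_mul_inv, ENNReal.div_le_iff hV0 hVT]
  have h1 := ENNReal.rpow_le_rpow (h x R hR l hl) (z := 1 / r) (by positivity)
  rw [ENNReal.mul_rpow_of_nonneg _ _ (by positivity), ENNReal.mul_rpow_of_nonneg _ _ (by positivity),
    ← ENNReal.rpow_mul, ← ENNReal.rpow_mul, ← ENNReal.rpow_mul, mul_one_div_cancel hr.ne',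
    ENNReal.rpow_one, ENNReal.rpow_one, mul_one_div] at h1
  convert h1 using 5
  ext y
  rw [← ofReal_norm, ENNReal.ofReal_lt_ofReal_iff']
  exact ⟨fun h => ⟨h.1, h.2, hl.trans h.2⟩, fun h => ⟨h.1, h.2.1⟩⟩

theorem fracIntegrand_congr_ae [Nontrivial (EuclideanSpace ℝ (Fin n))]
    {Ω Ω' g g' : Fin m → EuclideanSpace ℝ (Fin n) → 𝕜} (α : ℝ)
    (hΩ : ∀ i, Ω i =ᵐ[volume] Ω' i) (hg : ∀ i, g i =ᵐ[volume] g' i)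
    (x : EuclideanSpace ℝ (Fin n)) : fracIntegrand Ω α g x =ᵐ[volume] fracIntegrand Ω' α g' x := by
  have hev := Measure.quasiMeasurePreserving_eval
    (fun _ : Fin m => (volume : Measure (EuclideanSpace ℝ (Fin n))))
  have h1 : ∀ᵐ y : Fin m → EuclideanSpace ℝ (Fin n), ∀ i, g i (y i) = g' i (y i) :=
    ae_all_iff.2 fun i => (hev i).ae (hg i)
  have h2 : ∀ᵐ y : Fin m → EuclideanSpace ℝ (Fin n), ∀ i, Ω i (x - y i) = Ω' i (x - y i) :=
    ae_all_iff.2 fun i => (hev i).ae ((quasiMeasurePreserving_sub_left volume x).ae (hΩ i))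
  filter_upwards [h1, h2] with y hy1 hy2
  simp only [fracIntegrand, hy1, hy2]

theorem measurable_uncurry_fracIntegrand {Ω g : Fin m → EuclideanSpace ℝ (Fin n) → 𝕜} (α : ℝ)
    (hΩ : ∀ i, Measurable (Ω i)) (hg : ∀ i, Measurable (g i)) :
    Measurable (Function.uncurry (fracIntegrand Ω α g)) := by
  unfold fracIntegrand Function.uncurry
  fun_prop

theorem aestronglyMeasurable_fracIntegrand [Nontrivial (EuclideanSpace ℝ (Fin n))]
    {Ω g : Fin m → EuclideanSpace ℝ (Fin n) → 𝕜} (α : ℝ)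
    (hΩ : ∀ i, AEStronglyMeasurable (Ω i)) (hg : ∀ i, AEStronglyMeasurable (g i))
    (x : EuclideanSpace ℝ (Fin n)) : AEStronglyMeasurable (fracIntegrand Ω α g x) :=
  ⟨fracIntegrand (fun i => (hΩ i).mk) α (fun i => (hg i).mk) x,
    ((measurable_uncurry_fracIntegrand α (fun i => (hΩ i).stronglyMeasurable_mk.measurable)
      fun i => (hg i).stronglyMeasurable_mk.measurable).comp
        measurable_prodMk_left).stronglyMeasurable,
    fracIntegrand_congr_ae α (fun i => (hΩ i).ae_eq_mk) (fun i => (hg i).ae_eq_mk) x⟩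

/-- Passing to Borel representatives of Ω and g changes the integrand only on a null set for every
x, so the operator's value is the same everywhere and is a parametrised integral of a jointly
measurable function. -/
theorem stronglyMeasurable_fracIntegral [Nontrivial (EuclideanSpace ℝ (Fin n))]
    {Ω g : Fin m → EuclideanSpace ℝ (Fin n) → 𝕜} (α : ℝ)
    (hΩ : ∀ i, AEStronglyMeasurable (Ω i)) (hg : ∀ i, AEStronglyMeasurable (g i)) :
    StronglyMeasurable (fracIntegral Ω α g) := by
  have h : fracIntegral Ω α g =
      fracIntegral (fun i => (hΩ i).mk) α (fun i => (hg i).mk) := funext fun x =>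
    integral_congr_ae
      (fracIntegrand_congr_ae α (fun i => (hΩ i).ae_eq_mk) (fun i => (hg i).ae_eq_mk) x)
  rw [h]
  exact StronglyMeasurable.integral_prod_right
    (measurable_uncurry_fracIntegrand α (fun i => (hΩ i).stronglyMeasurable_mk.measurable)
      fun i => (hg i).stronglyMeasurable_mk.measurable).stronglyMeasurable

end Morrey

/-! ### The maximal function of t-means. -/

section PowerMaximal

set_option linter.unusedSectionVars false

variable {E : Type*} [NormedAddCommGroup E] [NormedSpace ℝ E] [FiniteDimensional ℝ E]
  [MeasureSpace E] [BorelSpace E] [(volume : Measure E).IsAddHaarMeasure] [Nontrivial E]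

/-- The maximal function of the `t`-means over balls of dyadic radii. -/
noncomputable def powerMaximal (t : ℝ) (γ : E → ℝ≥0∞) (x : E) : ℝ≥0∞ :=
  dyadicMaximal (fun y => γ y ^ t) x ^ (1 / t)

theorem measurable_powerMaximal (t : ℝ) {γ : E → ℝ≥0∞} (hγ : AEMeasurable γ) :
    Measurable (powerMaximal t γ) :=
  (measurable_dyadicMaximal (hγ.pow_const t)).pow_const _

theorem rpow_const_congr_ae {γ γ' : E → ℝ≥0∞} (h : γ =ᵐ[volume] γ') (u : ℝ) :
    (fun y => γ y ^ u) =ᵐ[volume] fun y => γ' y ^ u :=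
  h.fun_comp (· ^ u)

theorem dyadicMaximal_congr_ae {h h' : E → ℝ≥0∞} (hh : h =ᵐ[volume] h') :
    dyadicMaximal h = dyadicMaximal h' := by
  funext x
  simp only [dyadicMaximal, ballMean_congr_ae hh]

theorem powerMaximal_congr_ae (t : ℝ) {γ γ' : E → ℝ≥0∞} (h : γ =ᵐ[volume] γ') :
    powerMaximal t γ = powerMaximal t γ' := by
  funext x
  rw [powerMaximal, powerMaximal,
    dyadicMaximal_congr_ae (rpow_const_congr_ae h t)]

/-- Jensen with exponent u/t ≥ 1 on each ball. It reduces the weak bound at every u ≥ t, endpoint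
included, to the weak type of the maximal function of γ^u. -/
theorem powerMaximal_rpow_le {t u : ℝ} (ht : 0 < t) (htu : t ≤ u) {γ : E → ℝ≥0∞}
    (hγ : AEMeasurable γ) (x : E) :
    powerMaximal t γ x ^ u ≤ dyadicMaximal (fun y => γ y ^ u) x := by
  have hu : 0 < u := ht.trans_le htu
  rw [powerMaximal, ← ENNReal.rpow_mul, one_div_mul_eq_div,
    ← ENNReal.le_rpow_inv_iff (by positivity)]
  refine iSup_le fun k => ?_
  rw [ENNReal.le_rpow_inv_iff (by positivity)]
  refine (ballMean_rpow_le ((one_le_div ht).2 htu) (hγ.pow_const t) (by positivity) x).trans ?_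
  simp_rw [← ENNReal.rpow_mul, mul_div_cancel₀ u ht.ne']
  exact le_iSup (fun k : ℤ => ballMean ((2 : ℝ) ^ k) (fun y => γ y ^ u) x) k

variable (E) in
/-- The strong Morrey bound of the maximal function of `t`-means. -/
theorem exists_setLIntegral_powerMaximal_rpow_le {t u κ : ℝ} (ht : 0 < t) (htu : t < u)
    (hκ₀ : 0 ≤ κ) (hκ₁ : κ ≤ 1) :
    ∃ C : ℝ≥0∞, C ≠ ∞ ∧ ∀ γ : E → ℝ≥0∞, AEMeasurable γ → ∀ N : ℝ≥0∞,
      (∀ (x : E) (R : ℝ), 0 < R →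
        ∫⁻ y in Metric.ball x R, γ y ^ u ≤ N * volume (Metric.ball x R) ^ κ) →
      ∀ (x : E) (R : ℝ), 0 < R →
        ∫⁻ y in Metric.ball x R, powerMaximal t γ y ^ u ≤
          C * (N * volume (Metric.ball x R) ^ κ) := by
  obtain ⟨C, hCT, hC⟩ := exists_setLIntegral_dyadicMaximal_rpow_le E ((one_lt_div ht).2 htu)
    hκ₀ hκ₁
  refine ⟨C, hCT, fun γ hγ N hN x R hR => ?_⟩
  have := hC (fun y => hγ.mk γ y ^ t) (hγ.measurable_mk.pow_const t) N (fun x R hR => by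
    simp_rw [← ENNReal.rpow_mul, mul_div_cancel₀ u ht.ne']
    rw [← lintegral_congr_ae (ae_restrict_of_ae (rpow_const_congr_ae hγ.ae_eq_mk u))]
    exact hN x R hR) x R hR
  rw [powerMaximal_congr_ae t hγ.ae_eq_mk]
  simp_rw [powerMaximal, ← ENNReal.rpow_mul, one_div_mul_eq_div]
  exact this

variable (E) in
/-- The weak Morrey bound of the maximal function of `t`-means. -/
theorem exists_rpow_mul_volume_lt_powerMaximal_le {t u κ : ℝ} (ht : 0 < t) (htu : t ≤ u)
    (hκ₀ : 0 ≤ κ) (hκ₁ : κ ≤ 1) :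
    ∃ C : ℝ≥0∞, C ≠ ∞ ∧ ∀ γ : E → ℝ≥0∞, AEMeasurable γ → ∀ N : ℝ≥0∞,
      (∀ (x : E) (R : ℝ), 0 < R →
        ∫⁻ y in Metric.ball x R, γ y ^ u ≤ N * volume (Metric.ball x R) ^ κ) →
      ∀ (x : E) (R : ℝ), 0 < R → ∀ l : ℝ≥0∞,
        l ^ u * volume.restrict (Metric.ball x R) {y | l < powerMaximal t γ y} ≤
          C * (N * volume (Metric.ball x R) ^ κ) := by
  obtain ⟨C, hCT, hC⟩ := exists_mul_volume_lt_dyadicMaximal_le E hκ₀ hκ₁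
  refine ⟨C, hCT, fun γ hγ N hN x R hR l => ?_⟩
  have := hC (fun y => hγ.mk γ y ^ u) (hγ.measurable_mk.pow_const u) N (fun x R hR => by
    rw [← lintegral_congr_ae (ae_restrict_of_ae (rpow_const_congr_ae hγ.ae_eq_mk u))]
    exact hN x R hR) x R hR (l ^ u)
  refine le_trans (mul_le_mul' le_rfl ?_) this
  rw [Measure.restrict_apply' measurableSet_ball]
  refine measure_mono fun y hy => ⟨hy.2, ?_⟩
  rw [← dyadicMaximal_congr_ae (rpow_const_congr_ae hγ.ae_eq_mk u)]
  exact (ENNReal.rpow_lt_rpow hy.1 (ht.trans_le htu)).trans_le (powerMaximal_rpow_le ht htu hγ y)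

/-- A function with finite weak norms on balls is finite almost everywhere. -/
theorem ae_ne_top_of_rpow_mul_volume_lt_le {M : E → ℝ≥0∞} {u : ℝ} (hu : 0 < u) {N : E → ℝ → ℝ≥0∞}
    (hN : ∀ x R, N x R ≠ ∞)
    (h : ∀ (x : E) (R : ℝ), 0 < R → ∀ l : ℝ≥0∞,
      l ^ u * volume.restrict (Metric.ball x R) {y | l < M y} ≤ N x R) :
    ∀ᵐ x, M x ≠ ∞ := by
  rw [← Measure.restrict_univ (μ := (volume : Measure E)), ← Metric.iUnion_ball_nat_succ (0 : E),
    ae_restrict_iUnion_iff]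
  intro k
  have hk : (0 : ℝ) < k + 1 := by positivity
  rw [ae_iff]
  set B := Metric.ball (0 : E) (k + 1) with hB
  set v := volume.restrict B {x | ¬ M x ≠ ∞} with hv
  have hvT : v ≠ ∞ := ne_top_of_le_ne_top (volume_ball_ne_top (0 : E) (k + 1))
    ((measure_mono (Set.subset_univ _)).trans (by rw [Measure.restrict_apply_univ]))
  by_contra hv0
  -- Chosen so that l^u v = N + 1, which the weak bound at height l forbids.
  set l : ℝ≥0∞ := ((N 0 (k + 1) + 1) / v) ^ (1 / u) with hl
  have hlT : l ≠ ∞ := ENNReal.rpow_ne_top_of_nonneg (by positivity)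
    (ENNReal.div_ne_top (by simp [hN]) hv0)
  have h1 : l ^ u * v ≤ N 0 (k + 1) := by
    refine le_trans (mul_le_mul' le_rfl (measure_mono fun x hx => ?_)) (h 0 (k + 1) hk l)
    have hx' : M x = ∞ := not_not.1 hx
    change l < M x
    rw [hx']
    exact hlT.lt_top
  rw [hl, ← ENNReal.rpow_mul, one_div_mul_cancel hu.ne', ENNReal.rpow_one,
    ENNReal.div_mul_cancel hv0 hvT] at h1
  exact absurd h1 (not_le.2 (ENNReal.lt_add_right (hN _ _) one_ne_zero))

end PowerMaximal

/-! ### From the pointwise bound to Morrey estimates, and the theorem. -/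

section Main

variable {𝕜 : Type*} [RCLike 𝕜] {n m : ℕ}

/-- The almost everywhere convergence of the multilinear fractional integral together with its
pointwise bound by maximal functions that satisfy weak Morrey estimates. -/
theorem exists_enorm_fracIntegral_le [Nontrivial (EuclideanSpace ℝ (Fin n))]
    {s : ℝ≥0∞} (hs : 1 < s)
    {Ω : Fin m → EuclideanSpace ℝ (Fin n) → 𝕜} (hΩ : ∀ i, IsRoughKernel s (Ω i))
    {α : ℝ} (hα₀ : 0 < α) (hα : α < (m : ℝ) * (n : ℝ)) {t : ℝ}
    (ht : t = (ENNReal.conjExponent s).toReal) {P : Fin m → ℝ} (hP : ∀ i, t ≤ P i)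
    {κ : ℝ} (hκ₀ : 0 ≤ κ) (hκ₁ : κ < 1) {σ : ℝ} (hσ : 0 < σ) (hσ₁ : σ < 1)
    (hσS : σ * (∑ i, 1 / P i) = ∑ i, 1 / P i - α / ((n : ℝ) * (1 - κ)))
    (hS : 0 < ∑ i, 1 / P i) (hn : 0 < (n : ℝ)) :
    ∃ C : ℝ≥0∞, C ≠ 0 ∧ C ≠ ∞ ∧ ∀ (g : Fin m → EuclideanSpace ℝ (Fin n) → 𝕜),
      (∀ i, MemMorrey (P i) κ (g i)) →
      (∀ᵐ x, Integrable (fracIntegrand Ω α g x)) ∧ ∀ x, ‖fracIntegral Ω α g x‖ₑ ≤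
        C * ((∏ i, powerMaximal t (fun y => ‖g i y‖ₑ) x) ^ σ *
          (∏ i, morreyNorm (P i) κ (g i)) ^ (1 - σ)) := by
  have ht1 : 1 ≤ t := ht ▸ one_le_toReal_conjExponent hs
  have hP0 : ∀ i, 0 < P i := fun i => by linarith [hP i]
  obtain ⟨C, hCT, hC⟩ := exists_lintegral_enorm_fracIntegrand_le hs hΩ hα₀ hα ht hP hκ₁ hσ hσS hS hn
  choose W hWT hW using fun i => exists_rpow_mul_volume_lt_powerMaximal_le
    (EuclideanSpace ℝ (Fin n)) (by linarith : 0 < t) (hP i) hκ₀ hκ₁.le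
  -- The constant is made nonzero because the weak estimate later divides by it.
  refine ⟨C + 1, by simp, by simp [hCT], fun g hg => ?_⟩
  have hGT : ∀ i, morreyNorm (P i) κ (g i) ≠ ∞ := fun i => (hg i).2.ne
  have hbound := hC g (fun i => (hg i).1) (fun i => morreyNorm (P i) κ (g i)) hGT
    (fun i => setLIntegral_enorm_rpow_le_morreyNorm (hP0 i) (g i))
  have hΩm : ∀ i, AEStronglyMeasurable (Ω i) := fun i =>
    aestronglyMeasurable_of_homogeneous (hΩ i).homogeneous (hΩ i).memLp_toSphere.1
  refine ⟨?_, fun x => (enorm_integral_le_lintegral_enorm _).trans ((hbound x).trans ?_)⟩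
  · have hfin : ∀ᵐ x, ∀ i, powerMaximal t (fun y => ‖g i y‖ₑ) x ≠ ∞ := ae_all_iff.2 fun i =>
      ae_ne_top_of_rpow_mul_volume_lt_le (hP0 i) (N := fun x R =>
        W i * (morreyNorm (P i) κ (g i) ^ P i * volume (Metric.ball x R) ^ κ))
        (fun x R => ENNReal.mul_ne_top (hWT i) (ENNReal.mul_ne_top
          (ENNReal.rpow_ne_top_of_nonneg (hP0 i).le (hGT i))
          (ENNReal.rpow_ne_top_of_nonneg hκ₀ (volume_ball_ne_top _ _))))
        (hW i _ (hg i).1.enorm _ (setLIntegral_enorm_rpow_le_morreyNorm (hP0 i) (g i)))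
    filter_upwards [hfin] with x hx
    refine ⟨aestronglyMeasurable_fracIntegrand α hΩm (fun i => (hg i).1) x,
      (hbound x).trans_lt (ENNReal.mul_lt_top hCT.lt_top (ENNReal.mul_lt_top ?_ ?_))⟩
    · exact (ENNReal.rpow_ne_top_of_nonneg hσ.le (ENNReal.prod_ne_top fun i _ => hx i)).lt_top
    · exact (ENNReal.rpow_ne_top_of_nonneg (by linarith)
        (ENNReal.prod_ne_top fun i _ => hGT i)).lt_top
  · exact mul_le_mul' le_self_add le_rfl

/-- Hölder on each ball for f and the maximal functions produces G^σ, where G is the product of the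
Morrey norms of the g_i; the pointwise bound contributes G^{1-σ}, and the two multiply to G. -/
theorem strong_morrey_of_pointwise [Nontrivial (EuclideanSpace ℝ (Fin n))]
    {t : ℝ} (ht : 1 ≤ t) {P : Fin m → ℝ} (hP : ∀ i, t < P i)
    {κ : ℝ} (hκ₀ : 0 ≤ κ) (hκ₁ : κ < 1) {p r σ : ℝ} (hp : 0 < p) (hr : 0 < r) (hσ : 0 < σ)
    (hσ₁ : σ < 1) (hsum : r / p + ∑ i, r * σ / P i = 1) {C : ℝ≥0∞} (hCT : C ≠ ∞) :
    ∃ D : ℝ≥0∞, D ≠ ∞ ∧ ∀ (f T : EuclideanSpace ℝ (Fin n) → 𝕜)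
      (g : Fin m → EuclideanSpace ℝ (Fin n) → 𝕜), MemMorrey p κ f →
      (∀ i, MemMorrey (P i) κ (g i)) →
      (∀ x, ‖T x‖ₑ ≤ C * ((∏ i, powerMaximal t (fun y => ‖g i y‖ₑ) x) ^ σ *
          (∏ i, morreyNorm (P i) κ (g i)) ^ (1 - σ))) →
      morreyNorm r κ (fun x => f x * T x) ≤
        D * (morreyNorm p κ f * ∏ i, morreyNorm (P i) κ (g i)) := by
  have hP0 : ∀ i, 0 < P i := fun i => by linarith [hP i]
  choose A hAT hA using fun i => exists_setLIntegral_powerMaximal_rpow_le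
    (EuclideanSpace ℝ (Fin n)) (by linarith : 0 < t) (hP i) hκ₀ hκ₁.le
  have hw : ∀ i, 0 ≤ r * σ / P i := fun i => by have := hP0 i; positivity
  set Q := ∏ i, A i ^ (r * σ / P i) with hQ
  have hQT : Q ≠ ∞ := ENNReal.prod_ne_top fun i _ => ENNReal.rpow_ne_top_of_nonneg (hw i) (hAT i)
  refine ⟨C * Q ^ (1 / r), ENNReal.mul_ne_top hCT (ENNReal.rpow_ne_top_of_nonneg (by positivity) hQT),
    fun f T g hf hg hT => morreyNorm_le_of_forall hr fun x R hR => ?_⟩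
  set G := ∏ i, morreyNorm (P i) κ (g i) with hG
  have hGT : G ≠ ∞ := ENNReal.prod_ne_top fun i _ => (hg i).2.ne
  have hV0 : volume (Metric.ball x R) ^ κ ≠ 0 := by
    simp [ENNReal.rpow_eq_zero_iff, volume_ball_ne_zero x hR, volume_ball_ne_top x R]
  have hVT : volume (Metric.ball x R) ^ κ ≠ ∞ :=
    ENNReal.rpow_ne_top_of_ne_zero (volume_ball_ne_zero x hR) (volume_ball_ne_top x R)
  have hGG : G ^ σ * G ^ (1 - σ) = G := by
    rw [← ENNReal.rpow_add_of_nonneg _ _ hσ.le (by linarith), add_sub_cancel, ENNReal.rpow_one]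
  have hmul : ∀ a b : ℝ≥0∞, (a * b) ^ r = a ^ r * b ^ r := fun a b =>
    ENNReal.mul_rpow_of_nonneg a b hr.le
  calc ∫⁻ y in Metric.ball x R, ‖f y * T y‖ₑ ^ r
      ≤ ∫⁻ y in Metric.ball x R, (C * G ^ (1 - σ)) ^ r *
          (‖f y‖ₑ * (∏ i, powerMaximal t (fun y => ‖g i y‖ₑ) y) ^ σ) ^ r := by
        refine lintegral_mono fun y => ?_
        rw [← hmul, enorm_mul]
        refine ENNReal.rpow_le_rpow ((mul_le_mul' le_rfl (hT y)).trans (le_of_eq ?_)) hr.le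
        ring
    _ = (C * G ^ (1 - σ)) ^ r * ∫⁻ y in Metric.ball x R,
          (‖f y‖ₑ * (∏ i, powerMaximal t (fun y => ‖g i y‖ₑ) y) ^ σ) ^ r := by
        refine lintegral_const_mul' _ _ (ENNReal.rpow_ne_top_of_nonneg hr.le ?_)
        exact ENNReal.mul_ne_top hCT (ENNReal.rpow_ne_top_of_nonneg (by linarith) hGT)
    _ ≤ (C * G ^ (1 - σ)) ^ r * (Q * (morreyNorm p κ f * G ^ σ) ^ r *
          volume (Metric.ball x R) ^ κ) := by
        refine mul_le_mul' le_rfl (lintegral_mul_prod_rpow_rpow_le hf.1.enorm.restrict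
          (fun i => (measurable_powerMaximal t (hg i).1.enorm).aemeasurable) hp hP0 hr hσ hsum
          hV0 hVT (setLIntegral_enorm_rpow_le_morreyNorm hp f x R hR) fun i => ?_)
        exact hA i _ (hg i).1.enorm _ (setLIntegral_enorm_rpow_le_morreyNorm (hP0 i) (g i)) x R hR
    _ = (C * Q ^ (1 / r) * (morreyNorm p κ f * (G ^ σ * G ^ (1 - σ)))) ^ r *
          volume (Metric.ball x R) ^ κ := by
        simp only [hmul, ← ENNReal.rpow_mul, one_div_mul_cancel hr.ne', ENNReal.rpow_one]
        ring
    _ = _ := by rw [hGG]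

theorem ae_eq_zero_of_morreyNorm_eq_zero [Nontrivial (EuclideanSpace ℝ (Fin n))] {p κ : ℝ}
    (hp : 0 < p) {f : EuclideanSpace ℝ (Fin n) → 𝕜} (hf : AEStronglyMeasurable f)
    (h : morreyNorm p κ f = 0) (x : EuclideanSpace ℝ (Fin n)) {R : ℝ} (hR : 0 < R) :
    ∀ᵐ y ∂volume.restrict (Metric.ball x R), f y = 0 := by
  have h1 := setLIntegral_enorm_rpow_le_morreyNorm (κ := κ) hp f x R hR
  rw [h, ENNReal.zero_rpow_of_pos hp, zero_mul, nonpos_iff_eq_zero,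
    lintegral_eq_zero_iff' (hf.enorm.restrict.pow_const p)] at h1
  filter_upwards [h1] with y hy
  simpa [hp, hp.not_gt] using hy

theorem weak_morrey_of_pointwise [Nontrivial (EuclideanSpace ℝ (Fin n))]
    {t : ℝ} (ht : 1 ≤ t) {P : Fin m → ℝ} (hP : ∀ i, t ≤ P i)
    {κ : ℝ} (hκ₀ : 0 ≤ κ) (hκ₁ : κ < 1) {p r σ : ℝ} (hp : 0 < p) (hr : 0 < r) (hσ : 0 < σ)
    (hσ₁ : σ < 1) (hsum : r / p + ∑ i, r * σ / P i = 1) {C : ℝ≥0∞} (hC0 : C ≠ 0) (hCT : C ≠ ∞) :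
    ∃ D : ℝ≥0∞, D ≠ ∞ ∧ ∀ (f T : EuclideanSpace ℝ (Fin n) → 𝕜)
      (g : Fin m → EuclideanSpace ℝ (Fin n) → 𝕜), MemMorrey p κ f →
      (∀ i, MemMorrey (P i) κ (g i)) →
      (∀ x, ‖T x‖ₑ ≤ C * ((∏ i, powerMaximal t (fun y => ‖g i y‖ₑ) x) ^ σ *
          (∏ i, morreyNorm (P i) κ (g i)) ^ (1 - σ))) →
      weakMorreyNorm r κ (fun x => f x * T x) ≤
        D * (morreyNorm p κ f * ∏ i, morreyNorm (P i) κ (g i)) := by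
  have hP0 : ∀ i, 0 < P i := fun i => by linarith [hP i]
  choose A hAT hA using fun i => exists_rpow_mul_volume_lt_powerMaximal_le
    (EuclideanSpace ℝ (Fin n)) (by linarith : 0 < t) (hP i) hκ₀ hκ₁.le
  set Q := 1 + ∑ i, A i with hQ
  have hQT : Q ≠ ∞ := ENNReal.add_ne_top.2 ⟨by simp, ENNReal.sum_ne_top.2 fun i _ => hAT i⟩
  refine ⟨C * Q ^ (1 / r), ENNReal.mul_ne_top hCT (ENNReal.rpow_ne_top_of_nonneg (by positivity) hQT),
    fun f T g hf hg hT => weakMorreyNorm_le_of_forall hr fun x R hR l hl => ?_⟩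
  have hset : volume {y | y ∈ Metric.ball x R ∧ ENNReal.ofReal l < ‖f y * T y‖ₑ} =
      volume.restrict (Metric.ball x R) {y | ENNReal.ofReal l < ‖f y * T y‖ₑ} := by
    rw [Measure.restrict_apply' measurableSet_ball, Set.inter_comm]
    rfl
  rw [hset]
  set G := ∏ i, morreyNorm (P i) κ (g i) with hG
  set F := morreyNorm p κ f with hF
  have hzero : (∀ᵐ y ∂volume.restrict (Metric.ball x R), f y * T y = 0) →
      volume.restrict (Metric.ball x R) {y | ENNReal.ofReal l < ‖f y * T y‖ₑ} = 0 := fun h => by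
    refine measure_mono_null (fun y hy => ?_) (ae_iff.1 h)
    intro h0
    have hy' : ENNReal.ofReal l < ‖f y * T y‖ₑ := hy
    rw [h0, enorm_zero] at hy'
    exact not_lt_zero hy'
  -- The level-set argument uses thresholds proportional to the norms, so zero norms are treated
  -- apart: F = 0 makes f vanish a.e. on the ball, and G = 0 makes T vanish identically because 1 -
  -- σ > 0.
  rcases eq_or_ne F 0 with hF0 | hF0
  · rw [hzero, mul_zero]
    · exact zero_le
    · filter_upwards [ae_eq_zero_of_morreyNorm_eq_zero hp hf.1 hF0 x hR] with y hy
      rw [hy, zero_mul]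
  rcases eq_or_ne G 0 with hG0 | hG0
  · rw [hzero, mul_zero]
    · exact zero_le
    · refine Filter.Eventually.of_forall fun y => ?_
      have := hT y
      rw [hG0, ENNReal.zero_rpow_of_pos (by linarith), mul_zero, mul_zero, nonpos_iff_eq_zero,
        enorm_eq_zero] at this
      rw [this, mul_zero]
  have hGi0 : ∀ i, morreyNorm (P i) κ (g i) ≠ 0 := fun i => by
    rw [hG, Finset.prod_ne_zero_iff] at hG0
    exact hG0 i (Finset.mem_univ i)
  have hGT : G ≠ ∞ := ENNReal.prod_ne_top fun i _ => (hg i).2.ne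
  have hFT : F ≠ ∞ := hf.2.ne
  have hGG : G ^ σ * G ^ (1 - σ) = G := by
    rw [← ENNReal.rpow_add_of_nonneg _ _ hσ.le (by linarith), add_sub_cancel, ENNReal.rpow_one]
  have hmul : ∀ a b : ℝ≥0∞, (a * b) ^ r = a ^ r * b ^ r := fun a b =>
    ENNReal.mul_rpow_of_nonneg a b hr.le
  have hH0 : C * (F * G) ≠ 0 := mul_ne_zero hC0 (mul_ne_zero hF0 hG0)
  have hHT : C * (F * G) ≠ ∞ := ENNReal.mul_ne_top hCT (ENNReal.mul_ne_top hFT hGT)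
  set ν := ENNReal.ofReal l / (C * (F * G)) with hν
  have hν0 : ν ≠ 0 := ENNReal.div_ne_zero.2 ⟨by simpa using hl, hHT⟩
  have hνT : ν ≠ ∞ := ENNReal.div_ne_top ENNReal.ofReal_ne_top hH0
  have hνl : ENNReal.ofReal l = ν * (C * (F * G)) := (ENNReal.div_mul_cancel hH0 hHT).symm
  have hweak := rpow_mul_measure_lt_mul_prod_rpow_le
    (μ := volume.restrict (Metric.ball x R)) (a := fun y => ‖f y‖ₑ)
    (M := fun i => powerMaximal t (fun y => ‖g i y‖ₑ)) (r := r) (V := volume (Metric.ball x R) ^ κ)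
    (G := fun i => morreyNorm (P i) κ (g i)) hp hP0 hσ hsum hF0 hFT hGi0 (fun i => (hg i).2.ne)
    -- For f the weak bound is Chebyshev's inequality.
    (fun l => by
      refine le_trans ?_ (setLIntegral_enorm_rpow_le_morreyNorm hp f x R hR)
      refine le_trans (mul_le_mul' le_rfl (measure_mono fun y hy => ?_))
        (mul_meas_ge_le_lintegral₀ (hf.1.enorm.restrict.pow_const p) (l ^ p))
      exact ENNReal.rpow_le_rpow (le_of_lt hy) hp.le)
    (fun i => hA i _ (hg i).1.enorm _ (setLIntegral_enorm_rpow_le_morreyNorm (hP0 i) (g i)) x R hR)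
    hν0 hνT
  have hKT : C * G ^ (1 - σ) ≠ ∞ :=
    ENNReal.mul_ne_top hCT (ENNReal.rpow_ne_top_of_nonneg (by linarith) hGT)
  calc ENNReal.ofReal l ^ r * volume.restrict (Metric.ball x R)
        {y | ENNReal.ofReal l < ‖f y * T y‖ₑ}
      ≤ ENNReal.ofReal l ^ r * volume.restrict (Metric.ball x R)
        {y | ν * (F * G ^ σ) < ‖f y‖ₑ * (∏ i, powerMaximal t (fun y => ‖g i y‖ₑ) y) ^ σ} := by
        refine mul_le_mul' le_rfl (measure_mono fun y hy => ?_)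
        have hy' : ENNReal.ofReal l < ‖f y * T y‖ₑ := hy
        by_contra hcon
        refine absurd hy' (not_lt.2 ?_)
        calc ‖f y * T y‖ₑ ≤ (C * G ^ (1 - σ)) *
              (‖f y‖ₑ * (∏ i, powerMaximal t (fun y => ‖g i y‖ₑ) y) ^ σ) := by
              rw [enorm_mul]
              exact (mul_le_mul' le_rfl (hT y)).trans (le_of_eq (by ring))
          _ ≤ (C * G ^ (1 - σ)) * (ν * (F * G ^ σ)) := mul_le_mul' le_rfl (not_lt.1 hcon)
          _ = ν * (C * (F * (G ^ σ * G ^ (1 - σ)))) := by ring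
          _ = ENNReal.ofReal l := by rw [hGG, hνl]
    _ = (C * (F * G)) ^ r * (ν ^ r * volume.restrict (Metric.ball x R)
        {y | ν * (F * G ^ σ) < ‖f y‖ₑ * (∏ i, powerMaximal t (fun y => ‖g i y‖ₑ) y) ^ σ}) := by
        rw [hνl, hmul ν]
        ring
    _ ≤ (C * (F * G)) ^ r * (Q * volume (Metric.ball x R) ^ κ) := mul_le_mul' le_rfl hweak
    _ = _ := by
        simp only [hmul, ← ENNReal.rpow_mul, one_div_mul_cancel hr.ne', ENNReal.rpow_one]
        ring

end Main

end OlsenMorrey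

theorem theorem6p4 {𝕜 : Type*} [RCLike 𝕜] {n m : ℕ} (hn : 2 ≤ n) (hm : 2 ≤ m)
    (s : ℝ≥0∞) (hs : 1 < s)
    (Ω : Fin m → EuclideanSpace ℝ (Fin n) → 𝕜) (hΩ : ∀ i, OlsenMorrey.IsRoughKernel s (Ω i))
    (α : ℝ) (hα₀ : 0 < α) (hα : α < (m : ℝ) * (n : ℝ))
    (p : ℝ) (hp : 1 ≤ p)
    (P : Fin m → ℝ) (hP : ∀ i, ENNReal.conjExponent s ≤ ENNReal.ofReal (P i))
    (κ : ℝ) (hκ₀ : 0 < κ) (hκ₁ : κ < 1)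
    (q r : ℝ) (hr₀ : 0 < r) (hr : r < min p q)
    (hq : 1 / q = ∑ i, 1 / P i - α / ((n : ℝ) * (1 - κ)))
    (hpr : 1 / p + ∑ i, 1 / P i = 1 / r + α / ((n : ℝ) * (1 - κ))) :
    -- the strong type inequality
    ((∀ i, ENNReal.conjExponent s < ENNReal.ofReal (P i)) →
      ∃ C : ℝ, 0 < C ∧
        ∀ (f : EuclideanSpace ℝ (Fin n) → 𝕜) (g : Fin m → EuclideanSpace ℝ (Fin n) → 𝕜),
          OlsenMorrey.MemMorrey p κ f → (∀ i, OlsenMorrey.MemMorrey (P i) κ (g i)) →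
            (∀ᵐ x : EuclideanSpace ℝ (Fin n),
              Integrable (OlsenMorrey.fracIntegrand Ω α g x)) ∧
            OlsenMorrey.MemMorrey r κ (fun x => f x * OlsenMorrey.fracIntegral Ω α g x) ∧
            OlsenMorrey.morreyNorm r κ (fun x => f x * OlsenMorrey.fracIntegral Ω α g x) ≤
              ENNReal.ofReal C * (OlsenMorrey.morreyNorm p κ f *
                ∏ i, OlsenMorrey.morreyNorm (P i) κ (g i))) ∧
    -- the weak type inequality
    (IsLeast (Set.range fun i => ENNReal.ofReal (P i)) (ENNReal.conjExponent s) →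
      ∃ C : ℝ, 0 < C ∧
        ∀ (f : EuclideanSpace ℝ (Fin n) → 𝕜) (g : Fin m → EuclideanSpace ℝ (Fin n) → 𝕜),
          OlsenMorrey.MemMorrey p κ f → (∀ i, OlsenMorrey.MemMorrey (P i) κ (g i)) →
            (∀ᵐ x : EuclideanSpace ℝ (Fin n),
              Integrable (OlsenMorrey.fracIntegrand Ω α g x)) ∧
            OlsenMorrey.MemWeakMorrey r κ (fun x => f x * OlsenMorrey.fracIntegral Ω α g x) ∧
            OlsenMorrey.weakMorreyNorm r κ (fun x => f x * OlsenMorrey.fracIntegral Ω α g x) ≤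
              ENNReal.ofReal C * (OlsenMorrey.morreyNorm p κ f *
                ∏ i, OlsenMorrey.morreyNorm (P i) κ (g i))) := by
  have hn0 : (0 : ℝ) < n := by
    have : 0 < n := by omega
    exact_mod_cast this
  have hnt : Nontrivial (EuclideanSpace ℝ (Fin n)) := by
    refine Module.nontrivial_of_finrank_pos (R := ℝ) ?_
    rw [finrank_euclideanSpace_fin]
    omega
  set t := (ENNReal.conjExponent s).toReal with ht
  have ht1 : 1 ≤ t := OlsenMorrey.one_le_toReal_conjExponent hs
  have hcT := OlsenMorrey.conjExponent_ne_top hs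
  have hPnn : ∀ i, 0 ≤ P i := fun i => by
    by_contra! hneg
    have h1 := hP i
    rw [ENNReal.ofReal_of_nonpos hneg.le] at h1
    simp [ENNReal.conjExponent] at h1
  have hPt : ∀ i, t ≤ P i := fun i => (ENNReal.le_ofReal_iff_toReal_le hcT (hPnn i)).1 (hP i)
  have hp0 : 0 < p := by linarith
  have hq0 : 0 < q := hr₀.trans (hr.trans_le (min_le_right _ _))
  set S := ∑ i, 1 / P i with hS
  set δ := (n : ℝ) * (1 - κ) with hδ
  have hδ0 : 0 < δ := mul_pos hn0 (by linarith)
  have hαδ : 0 < α / δ := by positivity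
  have hqinv : 0 < 1 / q := by positivity
  have hS0 : 0 < S := by linarith
  -- σ < 1 because 1/q falls short of S by α/δ > 0.
  set σ := 1 / q / S with hσ
  have hσ0 : 0 < σ := by positivity
  have hσ1 : σ < 1 := by rw [hσ, div_lt_one hS0]; linarith
  have hσS : σ * S = S - α / δ := by rw [← hq, hσ]; field_simp
  -- Since σS = 1/q, this is 1/p + 1/q = 1/r multiplied by r.
  have hsum : r / p + ∑ i, r * σ / P i = 1 := by
    have h1 : ∑ i, r * σ / P i = r * (σ * S) := by
      rw [hS, Finset.mul_sum, Finset.mul_sum]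
      exact Finset.sum_congr rfl fun i _ => by ring
    have h2 : 1 / p + σ * S = 1 / r := by linarith
    rw [h1]
    calc r / p + r * (σ * S) = r * (1 / p + σ * S) := by ring
      _ = 1 := by rw [h2]; field_simp
  have hΩm : ∀ i, AEStronglyMeasurable (Ω i) := fun i =>
    OlsenMorrey.aestronglyMeasurable_of_homogeneous (hΩ i).homogeneous (hΩ i).memLp_toSphere.1
  obtain ⟨C, hC0, hCT, hC⟩ := OlsenMorrey.exists_enorm_fracIntegral_le hs hΩ hα₀ hα ht hPt
    hκ₀.le hκ₁ hσ0 hσ1 hσS hS0 hn0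
  have hofReal : ∀ D : ℝ≥0∞, D ≠ ∞ → D ≤ ENNReal.ofReal (D.toReal + 1) := fun D hD =>
    (ENNReal.ofReal_toReal hD).symm.le.trans (ENNReal.ofReal_le_ofReal (by linarith))
  have hfin : ∀ (D : ℝ) (f : EuclideanSpace ℝ (Fin n) → 𝕜)
      (g : Fin m → EuclideanSpace ℝ (Fin n) → 𝕜), OlsenMorrey.MemMorrey p κ f →
      (∀ i, OlsenMorrey.MemMorrey (P i) κ (g i)) →
      ENNReal.ofReal D * (OlsenMorrey.morreyNorm p κ f *
        ∏ i, OlsenMorrey.morreyNorm (P i) κ (g i)) < ∞ := fun D f g hf hg =>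
    ENNReal.mul_lt_top ENNReal.ofReal_lt_top
      (ENNReal.mul_lt_top hf.2 (ENNReal.prod_lt_top fun i _ => (hg i).2))
  refine ⟨fun hPs => ?_, fun _ => ?_⟩
  · have hPt' : ∀ i, t < P i := fun i => (ENNReal.lt_ofReal_iff_toReal_lt hcT).1 (hPs i)
    obtain ⟨D, hDT, hD⟩ := OlsenMorrey.strong_morrey_of_pointwise (𝕜 := 𝕜) (n := n) ht1 hPt' hκ₀.le
      hκ₁ hp0 hr₀ hσ0 hσ1 hsum hCT
    refine ⟨D.toReal + 1, by positivity, fun f g hf hg => ?_⟩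
    have hle := (hD f _ g hf hg (hC g hg).2).trans (mul_le_mul' (hofReal D hDT) le_rfl)
    exact ⟨(hC g hg).1, ⟨hf.1.mul (OlsenMorrey.stronglyMeasurable_fracIntegral α hΩm
      fun i => (hg i).1).aestronglyMeasurable, hle.trans_lt (hfin _ f g hf hg)⟩, hle⟩
  · obtain ⟨D, hDT, hD⟩ := OlsenMorrey.weak_morrey_of_pointwise (𝕜 := 𝕜) (n := n) ht1 hPt hκ₀.le
      hκ₁ hp0 hr₀ hσ0 hσ1 hsum hC0 hCT
    refine ⟨D.toReal + 1, by positivity, fun f g hf hg => ?_⟩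
    have hle := (hD f _ g hf hg (hC g hg).2).trans (mul_le_mul' (hofReal D hDT) le_rfl)
    exact ⟨(hC g hg).1, ⟨hf.1.mul (OlsenMorrey.stronglyMeasurable_fracIntegral α hΩm
      fun i => (hg i).1).aestronglyMeasurable, hle.trans_lt (hfin _ f g hf hg)⟩, hle⟩
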